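/- Let $\epsilon>0$, let $n\ge 1$ be an integer and let $h>0$. Let $k_\epsilon(x)=(2\pi\epsilon^2)^{-d/2}e^{-\|x\|^2/(2\epsilon^2)}$ be the Gaussian kernel on $\mathbb R^d$, and for a probability measure $\mu$ on $\mathbb R^d$ let $k_\epsilon\star\mu$ denote both the function $\theta\mapsto\int k_\epsilon(\theta-y)\,d\mu(y)$ and the measure with this density. For $V:\mathbb R^d\to\mathbb R$ define the mollified relative entropy $$F_\epsilon(\mu)=\int V\,d(k_\epsilon\star\mu)+\int\log(k_\epsilon\star\mu)\,d(k_\epsilon\star\mu)$$ on the set $\mathcal P_2(\mathbb R^d)$ of probability measures with finite second moment, and let $F_\epsilon'(\mu)=k_\epsilon\star V+k_\epsilon\star(\log(k_\epsilon\star\mu)+1)$. There is a constant $K=K_{\epsilon,n,h}>0$, depending only on $\epsilon,n,h$, with the following property. Let $d\ge 0$, let $V:\mathbb R^d\to\mathbb R$ be differentiable with $\|\nabla V(x)-\nabla V(y)\|\le L\|x-y\|$ for all $x,y$ (with $L\ge 0$), and suppose $Z=\int e^{-V(x)}\,dx<\infty$. Put $M=L+K$, let $\gamma>0$ be a step size with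 $c_\gamma=\gamma(1-\gamma M/2)>0$, and let $(\mu_l)_{l\ge 0}$ be the Wasserstein gradient descent iterates $$\mu_{l+1}=(\mathrm{Id}-\gamma\nabla F_\epsilon'(\mu_l))_{\#}\mu_l,$$ started from $\mu_0=\frac1n\sum_{i=1}^n\delta_{x^i}$ with $x^1,\dots,x^n\in\mathbb R^d$. Suppose $\int\|x\|^2\,d\mu_l(x)<h$ for all $l\ge 0$. Then: 1. for every $\nu\in\mathcal P_2(\mathbb R^d)$ both integrals in $F_\epsilon(\nu)$ converge absolutely and $F_\epsilon(\nu)\ge-\log Z$; in particular $\inf F_\epsilon:=\inf_{\nu\in\mathcal P_2(\mathbb R^d)}F_\epsilon(\nu)$ is finite; 2. for every $l\ge 0$, $\mu_l\in\mathcal P_2(\mathbb R^d)$, and $F_\epsilon'(\mu_l)$ is differentiable and is the first variation of $F_\epsilon$ at $\mu_l$: for all $\mu\in\mathcal P_2(\mathbb R^d)$ it is integrable with respect to $\mu$ and to $\mu_l$, and $\lim_{s\downarrow 0}\frac1s\left[F_\epsilon((1-s)\mu_l+s\mu)-F_\epsilon(\mu_l)\right]=\int F_\epsilon'(\mu_l)\,d(\mu-\mu_l)$;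 3. for every integer $T\ge 1$, $$\frac1T\sum_{l=1}^{T}\|\nabla F_\epsilon'(\mu_l)\|^2_{L^2(\mu_l)}\le\frac{F_\epsilon(\mu_0)-\inf F_\epsilon}{c_\gamma T},$$ so that the right-hand side is at most $\frac{F_\epsilon(\mu_0)+\log Z}{c_\gamma T}$ by part 1, which is $\frac{F_\epsilon(\mu_0)}{c_\gamma T}$ if $e^{-V}$ is a normalized density; 4. $\sum_{l\ge 0}\|\nabla F_\epsilon'(\mu_l)\|^2_{L^2(\mu_l)}<\infty$, and $\|\nabla F_\epsilon'(\mu_l)\|^2_{L^2(\mu_l)}\to 0$ as $l\to\infty$. -/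

import Mathlib

open MeasureTheory Filter Topology

noncomputable section

namespace MollifiedVI

/-- The Euclidean space of dimension `d`. -/
abbrev Rd (d : ℕ) : Type := EuclideanSpace ℝ (Fin d)

/-- Probability measures with finite second moment. -/
def P2 (d : ℕ) : Set (Measure (Rd d)) :=
  {μ | IsProbabilityMeasure μ ∧ Integrable (fun x => ‖x‖ ^ 2) μ}

/-- The uniform measure on the `n` (not necessarily distinct) points `x i`. -/
def empirical {d n : ℕ} (x : Fin n → Rd d) : Measure (Rd d) :=
  (n : ENNReal)⁻¹ • ∑ i, Measure.dirac (x i)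

/-- The Gaussian kernel: the density of the centred Gaussian law with covariance `ε ^ 2 • I`. -/
def kern {d : ℕ} (ε : ℝ) (x : Rd d) : ℝ :=
  ((2 * Real.pi * ε ^ 2) ^ ((d : ℝ) / 2))⁻¹ * Real.exp (-‖x‖ ^ 2 / (2 * ε ^ 2))

/-- The density of the convolution of the Gaussian kernel with `μ`. -/
def molDensity {d : ℕ} (ε : ℝ) (μ : Measure (Rd d)) (θ : Rd d) : ℝ :=
  ∫ y, kern ε (θ - y) ∂μ

/-- The convolution of the Gaussian kernel with `μ`, as a measure. -/
def molMeasure {d : ℕ} (ε : ℝ) (μ : Measure (Rd d)) : Measure (Rd d) :=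
  volume.withDensity (fun θ => ENNReal.ofReal (molDensity ε μ θ))

/-- The mollified relative entropy
`F_ε(μ) = ∫ V d(k_ε ⋆ μ) + ∫ log (k_ε ⋆ μ) d(k_ε ⋆ μ)`. -/
def mollifiedKL {d : ℕ} (V : Rd d → ℝ) (ε : ℝ) (μ : Measure (Rd d)) : ℝ :=
  ∫ θ, V θ ∂(molMeasure ε μ) + ∫ θ, Real.log (molDensity ε μ θ) ∂(molMeasure ε μ)

/-- `f` is a first variation of `F` at `ν`: the one-sided derivative at `s = 0` of `F` along
`(1 - s) ν + s μ` is `∫ f d(μ - ν)`, for every `μ` with finite second moment. -/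
def IsFirstVariation {d : ℕ} (F : Measure (Rd d) → ℝ) (ν : Measure (Rd d))
    (f : Rd d → ℝ) : Prop :=
  Integrable f ν ∧ ∀ μ ∈ P2 d, Integrable f μ ∧
    Tendsto
      (fun s : ℝ => (F (ENNReal.ofReal (1 - s) • ν + ENNReal.ofReal s • μ) - F ν) / s)
      (𝓝[>] 0) (𝓝 (∫ x, f x ∂μ - ∫ x, f x ∂ν))

/-- The first variation `F_ε'(μ) = k_ε ⋆ V + k_ε ⋆ (log (k_ε ⋆ μ) + 1)`. -/
def firstVar {d : ℕ} (V : Rd d → ℝ) (ε : ℝ) (μ : Measure (Rd d)) (w : Rd d) : ℝ :=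
  (∫ θ, kern ε (θ - w) * V θ) + ∫ θ, kern ε (θ - w) * (Real.log (molDensity ε μ θ) + 1)

/-- The Wasserstein gradient `∇ F_ε'(μ)`. -/
def wassGrad {d : ℕ} (V : Rd d → ℝ) (ε : ℝ) (μ : Measure (Rd d)) : Rd d → Rd d :=
  gradient (firstVar V ε μ)

/-- The squared norm of `∇ F_ε'(μ)` in `L²(μ)`. -/
def gradNormSq {d : ℕ} (V : Rd d → ℝ) (ε : ℝ) (μ : Measure (Rd d)) : ℝ :=
  ∫ w, ‖wassGrad V ε μ w‖ ^ 2 ∂μ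

/-- Wasserstein gradient descent of `F_ε` with step size `γ`. -/
def IsWassGD {d : ℕ} (V : Rd d → ℝ) (ε γ : ℝ) (μ : ℕ → Measure (Rd d)) : Prop :=
  ∀ l, μ (l + 1) = (μ l).map (fun w => w - γ • wassGrad V ε (μ l) w)

/-- The infimum of `F_ε` over the probability measures with finite second moment. -/
def infKL {d : ℕ} (V : Rd d → ℝ) (ε : ℝ) : ℝ :=
  sInf (mollifiedKL V ε '' P2 d)

end MollifiedVI

end

open MeasureTheory Filter Topology

namespace MollifiedVI

variable {d n : ℕ} {ε : ℝ}

/-! ### The Gaussian kernel -/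

/-! Gradient descent decreases a functional as soon as that functional has a quadratic upper bound
along the step. Let `x` be the current particles, `y i = x i + u i` the moved ones, and p, q the
mollified densities of their empirical measures. Then F_ε at `y` is exactly the integral of F_ε'(x)
against the measure of `y`, minus 1, plus the relative entropy of q with respect to p.

The relative entropy is at most the average of ‖u i‖² / (2ε²): the log-sum inequality compares the
mixtures component by component, and each component is a pair of translated Gaussians
(`integral_molDensity_mul_log_sub_le`).

The linear term needs an upper quadratic bound on F_ε' = k_ε ⋆ (V + log p + 1). Convolution with a
probability density preserves such bounds (`conv_add_le`). V contributes L. For particles in the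
ball of radius R, Hoeffding's lemma under the posterior weights shows that log p contributes R²/ε⁴ -
1/ε² (`log_molDensity_empirical_add_le`). The -1/ε² cancels the cost of the relative entropy,
leaving L + R²/ε⁴ (`mollifiedKL_empirical_le`).

A second moment below h forces ‖x i‖² ≤ n h, so K = n h / ε⁴ serves at every iterate in every
dimension. Telescoping the descent inequality against the Gibbs lower bound -log Z gives the rate
and the summability. -/

lemma kern_const_pos (hε : 0 < ε) : 0 < ((2 * Real.pi * ε ^ 2) ^ ((d : ℝ) / 2))⁻¹ := by
  positivity

lemma kern_pos (hε : 0 < ε) (x : Rd d) : 0 < kern ε x :=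
  mul_pos (kern_const_pos hε) (Real.exp_pos _)

lemma continuous_kern : Continuous (kern ε : Rd d → ℝ) := by
  unfold kern; fun_prop

lemma kern_neg (x : Rd d) : kern ε (-x) = kern ε x := by
  simp [kern]

lemma kern_zero : kern ε (0 : Rd d) = ((2 * Real.pi * ε ^ 2) ^ ((d : ℝ) / 2))⁻¹ := by
  simp [kern]

lemma kern_le_kern_zero (hε : 0 < ε) (x : Rd d) : kern ε x ≤ kern ε (0 : Rd d) := by
  rw [kern_zero]
  refine mul_le_of_le_one_right (kern_const_pos hε).le (Real.exp_le_one_iff.2 ?_)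
  exact div_nonpos_of_nonpos_of_nonneg (neg_nonpos.2 (sq_nonneg _)) (by positivity)

lemma log_kern (hε : 0 < ε) (x : Rd d) :
    Real.log (kern ε x) = Real.log (kern ε (0 : Rd d)) - ‖x‖ ^ 2 / (2 * ε ^ 2) := by
  rw [kern_zero, kern, Real.log_mul (kern_const_pos hε).ne' (Real.exp_pos _).ne', Real.log_exp]
  ring

lemma kern_eq_exp (x : Rd d) :
    kern ε x = ((2 * Real.pi * ε ^ 2) ^ ((d : ℝ) / 2))⁻¹ *
      Real.exp (-(2 * ε ^ 2)⁻¹ * ‖x‖ ^ 2) := by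
  rw [kern]; congr 2; ring

lemma integrable_exp_neg_mul_sq_norm {b : ℝ} (hb : 0 < b) :
    Integrable (fun x : Rd d => Real.exp (-b * ‖x‖ ^ 2)) := by
  have h := GaussianFourier.integral_rexp_neg_mul_sq_norm (V := Rd d) hb
  by_contra hn
  rw [integral_undef hn] at h
  -- The integral of a non-integrable function is 0 by convention, while the Gaussian integral is
  -- positive.
  exact absurd h.symm (ne_of_gt (by positivity))

lemma integrable_kern (hε : 0 < ε) : Integrable (kern ε : Rd d → ℝ) := by
  simp only [funext kern_eq_exp]
  exact (integrable_exp_neg_mul_sq_norm (by positivity)).const_mul _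

lemma integral_kern (hε : 0 < ε) : ∫ x : Rd d, kern ε x = 1 := by
  simp only [kern_eq_exp]
  rw [integral_const_mul, GaussianFourier.integral_rexp_neg_mul_sq_norm (by positivity),
    finrank_euclideanSpace_fin, div_inv_eq_mul, inv_mul_eq_one₀ (by positivity)]
  congr 1; ring

/-- Half of the Gaussian exponent absorbs the quadratic factor; the other half remains integrable.
-/
lemma integrable_kern_mul_one_add_sq (hε : 0 < ε) :
    Integrable (fun x : Rd d => kern ε x * (1 + ‖x‖ ^ 2)) := by
  set b : ℝ := (2 * ε ^ 2)⁻¹ with hb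
  have hb0 : 0 < b := by positivity
  refine (((integrable_exp_neg_mul_sq_norm (d := d) (half_pos hb0)).const_mul
    (((2 * Real.pi * ε ^ 2) ^ ((d : ℝ) / 2))⁻¹ * (1 + 2 / b)))).mono'
    (continuous_kern.mul (by fun_prop)).aestronglyMeasurable (ae_of_all _ fun x => ?_)
  rw [Real.norm_of_nonneg (mul_nonneg (kern_pos hε x).le (by positivity)), kern_eq_exp, ← hb,
    mul_assoc _ (Real.exp _), mul_assoc _ (1 + 2 / b)]
  refine mul_le_mul_of_nonneg_left ?_ (kern_const_pos hε).le
  have h1 : Real.exp (-b * ‖x‖ ^ 2) =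
      Real.exp (-(b / 2) * ‖x‖ ^ 2) * Real.exp (-(b / 2 * ‖x‖ ^ 2)) := by
    rw [← Real.exp_add]; congr 1; ring
  rw [h1, mul_assoc, mul_comm (1 + 2 / b)]
  refine mul_le_mul_of_nonneg_left ?_ (Real.exp_pos _).le
  rw [Real.exp_neg, inv_mul_le_iff₀ (Real.exp_pos _)]
  have h2 := Real.add_one_le_exp (b / 2 * ‖x‖ ^ 2)
  have h3 : 0 ≤ b / 2 * ‖x‖ ^ 2 := by positivity
  calc 1 + ‖x‖ ^ 2 = 1 + 2 / b * (b / 2 * ‖x‖ ^ 2) := by field_simp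
    _ ≤ (b / 2 * ‖x‖ ^ 2 + 1) * (1 + 2 / b) := by
        have : 0 < 2 / b := by positivity
        nlinarith
    _ ≤ _ := by gcongr

/-! ### Functions of quadratic growth -/

/-- Continuous functions with at most quadratic growth. -/
def QuadGrowth (g : Rd d → ℝ) : Prop :=
  Continuous g ∧ ∃ A, 0 ≤ A ∧ ∀ x, |g x| ≤ A * (1 + ‖x‖ ^ 2)

lemma QuadGrowth.add {f g : Rd d → ℝ} (hf : QuadGrowth f) (hg : QuadGrowth g) :
    QuadGrowth (fun x => f x + g x) := by
  obtain ⟨hfc, A, hA, hfA⟩ := hf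
  obtain ⟨hgc, B, hB, hgB⟩ := hg
  refine ⟨hfc.add hgc, A + B, by positivity, fun x => (abs_add_le _ _).trans ?_⟩
  linarith [hfA x, hgB x]

lemma quadGrowth_const (c : ℝ) : QuadGrowth (fun _ : Rd d => c) :=
  ⟨continuous_const, |c|, abs_nonneg c, fun x => by
    nlinarith [abs_nonneg c, mul_nonneg (abs_nonneg c) (sq_nonneg ‖x‖)]⟩

lemma QuadGrowth.abs {g : Rd d → ℝ} (hg : QuadGrowth g) : QuadGrowth (fun x => |g x|) := by
  obtain ⟨hgc, A, hA, hgA⟩ := hg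
  exact ⟨hgc.abs, A, hA, fun x => by rw [abs_abs]; exact hgA x⟩

lemma QuadGrowth.comp_add {g : Rd d → ℝ} (hg : QuadGrowth g) (w : Rd d) :
    QuadGrowth (fun x => g (x + w)) := by
  obtain ⟨hgc, A, hA, hgA⟩ := hg
  refine ⟨by fun_prop, A * (2 + 2 * ‖w‖ ^ 2), by positivity, fun x => (hgA _).trans ?_⟩
  rw [mul_assoc]
  refine mul_le_mul_of_nonneg_left ?_ hA
  have h1 : ‖x + w‖ ^ 2 ≤ (‖x‖ + ‖w‖) ^ 2 := by gcongr; exact norm_add_le _ _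
  nlinarith [sq_nonneg (‖x‖ - ‖w‖), mul_nonneg (sq_nonneg ‖x‖) (sq_nonneg ‖w‖)]

lemma quadGrowth_sq_norm : QuadGrowth (fun x : Rd d => ‖x‖ ^ 2) :=
  ⟨by fun_prop, 1, zero_le_one, fun x => by rw [abs_of_nonneg (sq_nonneg _)]; linarith⟩

lemma QuadGrowth.integrable_kern_mul {g : Rd d → ℝ} (hg : QuadGrowth g) (hε : 0 < ε) :
    Integrable (fun z => kern ε z * g z) := by
  obtain ⟨hgc, A, hA, hgA⟩ := hg
  refine ((integrable_kern_mul_one_add_sq hε).const_mul A).mono'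
    (continuous_kern.mul hgc).aestronglyMeasurable (ae_of_all _ fun x => ?_)
  rw [norm_mul, Real.norm_of_nonneg (kern_pos hε x).le, Real.norm_eq_abs]
  nlinarith [hgA x, kern_pos hε x, mul_le_mul_of_nonneg_left (hgA x) (kern_pos hε x).le]

/-- The convolution of the Gaussian kernel with a function. -/
noncomputable def conv (ε : ℝ) (g : Rd d → ℝ) (w : Rd d) : ℝ := ∫ θ, kern ε (θ - w) * g θ

/-- Moving the translation from the kernel to `g` lets growth bounds, derivatives and quadratic
bounds of `g` pass through the integral without differentiating the kernel. -/
lemma conv_eq (g : Rd d → ℝ) (w : Rd d) : conv ε g w = ∫ z, kern ε z * g (z + w) := by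
  rw [conv, ← integral_add_right_eq_self _ w]
  simp

lemma QuadGrowth.integrable_kern_sub_mul {g : Rd d → ℝ} (hg : QuadGrowth g) (hε : 0 < ε)
    (w : Rd d) : Integrable (fun θ => kern ε (θ - w) * g θ) := by
  have := ((hg.comp_add w).integrable_kern_mul hε).comp_sub_right w
  simpa using this

lemma conv_const (hε : 0 < ε) (c : ℝ) (w : Rd d) : conv ε (fun _ => c) w = c := by
  rw [conv_eq, integral_mul_const, integral_kern hε, one_mul]

lemma conv_add {f g : Rd d → ℝ} (hf : QuadGrowth f) (hg : QuadGrowth g) (hε : 0 < ε) (w : Rd d) :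
    conv ε (fun x => f x + g x) w = conv ε f w + conv ε g w := by
  simp only [conv, mul_add]
  exact integral_add (hf.integrable_kern_sub_mul hε w) (hg.integrable_kern_sub_mul hε w)

lemma exists_abs_conv_le {g : Rd d → ℝ} (hg : QuadGrowth g) (hε : 0 < ε) :
    ∃ B, 0 ≤ B ∧ ∀ w, |conv ε g w| ≤ B * (1 + ‖w‖ ^ 2) := by
  obtain ⟨hgc, A, hA, hgA⟩ := hg
  set m := ∫ z : Rd d, kern ε z * (1 + ‖z‖ ^ 2)
  have hm : 0 ≤ m := integral_nonneg fun z => mul_nonneg (kern_pos hε z).le (by positivity)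
  refine ⟨2 * A * m, by positivity, fun w => ?_⟩
  rw [conv_eq, ← Real.norm_eq_abs]
  calc ‖∫ z, kern ε z * g (z + w)‖
      ≤ ∫ z : Rd d, (kern ε z * (1 + ‖z‖ ^ 2)) * (2 * A * (1 + ‖w‖ ^ 2)) := by
        refine norm_integral_le_of_norm_le ((integrable_kern_mul_one_add_sq hε).mul_const _)
          (ae_of_all _ fun z => ?_)
        rw [norm_mul, Real.norm_of_nonneg (kern_pos hε z).le, mul_assoc, Real.norm_eq_abs]
        refine mul_le_mul_of_nonneg_left ((hgA _).trans ?_) (kern_pos hε z).le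
        have h1 : ‖z + w‖ ^ 2 ≤ (‖z‖ + ‖w‖) ^ 2 := by gcongr; exact norm_add_le _ _
        have h2 : 1 + ‖z + w‖ ^ 2 ≤ (1 + ‖z‖ ^ 2) * (2 * (1 + ‖w‖ ^ 2)) := by
          nlinarith [sq_nonneg (‖z‖ - ‖w‖), mul_nonneg (sq_nonneg ‖z‖) (sq_nonneg ‖w‖)]
        calc A * (1 + ‖z + w‖ ^ 2) ≤ A * ((1 + ‖z‖ ^ 2) * (2 * (1 + ‖w‖ ^ 2))) := by gcongr
          _ = _ := by ring
    _ = 2 * A * m * (1 + ‖w‖ ^ 2) := by rw [integral_mul_const]; ring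

/-! ### Mollified densities -/

/-- This is the Fubini input that exchanges mollifying the measure with convolving the test
function. -/
lemma integrable_prod_kern_mul {g : Rd d → ℝ} (hg : QuadGrowth g) (hε : 0 < ε)
    {μ : Measure (Rd d)} (hμ : μ ∈ P2 d) :
    Integrable (fun z : Rd d × Rd d => kern ε (z.2 - z.1) * g z.2) (μ.prod volume) := by
  have := hμ.1
  have hc : Continuous (fun z : Rd d × Rd d => kern ε (z.2 - z.1) * g z.2) :=
    (continuous_kern.comp (by fun_prop)).mul (hg.1.comp (by fun_prop))
  refine (integrable_prod_iff hc.aestronglyMeasurable).2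
    ⟨ae_of_all _ fun w => hg.integrable_kern_sub_mul hε w, ?_⟩
  obtain ⟨B, hB, hgB⟩ := exists_abs_conv_le hg.abs hε
  refine (((integrable_const (1 : ℝ)).add hμ.2).const_mul B).mono'
    hc.aestronglyMeasurable.norm.integral_prod_right' (ae_of_all _ fun w => ?_)
  refine le_of_eq_of_le ?_ (hgB w)
  rw [Real.norm_eq_abs, conv]
  simp only [norm_mul, Real.norm_of_nonneg (kern_pos hε _).le, Real.norm_eq_abs]

lemma integrable_conv {g : Rd d → ℝ} (hg : QuadGrowth g) (hε : 0 < ε)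
    {μ : Measure (Rd d)} (hμ : μ ∈ P2 d) : Integrable (conv ε g) μ := by
  have := hμ.1
  exact (integrable_prod_kern_mul hg hε hμ).integral_prod_left

lemma integrable_molDensity_mul {g : Rd d → ℝ} (hg : QuadGrowth g) (hε : 0 < ε)
    {μ : Measure (Rd d)} (hμ : μ ∈ P2 d) : Integrable (fun θ => molDensity ε μ θ * g θ) := by
  have := hμ.1
  refine (integrable_prod_kern_mul hg hε hμ).integral_prod_right.congr (ae_of_all _ fun θ => ?_)
  simp only [molDensity, integral_mul_const]

lemma integral_molDensity_mul {g : Rd d → ℝ} (hg : QuadGrowth g) (hε : 0 < ε)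
    {μ : Measure (Rd d)} (hμ : μ ∈ P2 d) :
    ∫ θ, molDensity ε μ θ * g θ = ∫ w, conv ε g w ∂μ := by
  have := hμ.1
  simp only [conv, molDensity]
  rw [integral_integral_swap (integrable_prod_kern_mul hg hε hμ)]
  simp only [integral_mul_const]

lemma integrable_kern_sub_left (hε : 0 < ε) {μ : Measure (Rd d)} [IsFiniteMeasure μ] (θ : Rd d) :
    Integrable (fun y => kern ε (θ - y)) μ :=
  (integrable_const (kern ε (0 : Rd d))).mono'
    (continuous_kern.comp (by fun_prop)).aestronglyMeasurable
    (ae_of_all _ fun y => by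
      rw [Real.norm_of_nonneg (kern_pos hε _).le]; exact kern_le_kern_zero hε _)

lemma continuous_molDensity (hε : 0 < ε) {μ : Measure (Rd d)} [IsFiniteMeasure μ] :
    Continuous (molDensity ε μ) := by
  refine continuous_of_dominated (bound := fun _ => kern ε (0 : Rd d))
    (fun θ => (integrable_kern_sub_left hε θ).aestronglyMeasurable)
    (fun θ => ae_of_all _ fun y => ?_) (integrable_const _)
    (ae_of_all _ fun y => continuous_kern.comp (by fun_prop))
  rw [Real.norm_of_nonneg (kern_pos hε _).le]; exact kern_le_kern_zero hε _

lemma molDensity_nonneg (hε : 0 < ε) (μ : Measure (Rd d)) (θ : Rd d) : 0 ≤ molDensity ε μ θ :=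
  integral_nonneg fun _ => (kern_pos hε _).le

lemma molDensity_le (hε : 0 < ε) {μ : Measure (Rd d)} [IsProbabilityMeasure μ] (θ : Rd d) :
    molDensity ε μ θ ≤ kern ε (0 : Rd d) := by
  calc molDensity ε μ θ ≤ ∫ _, kern ε (0 : Rd d) ∂μ :=
        integral_mono (integrable_kern_sub_left hε θ) (integrable_const _)
          fun y => kern_le_kern_zero hε _
    _ = _ := by simp

/-- This is Jensen's inequality by hand: the exponential lies above its tangent line at `a`, and the
linear correction `m - ‖y‖ ^ 2` has mean zero under `μ`. The bound makes the logarithm of the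
density grow at most quadratically. -/
lemma exists_exp_le_molDensity (hε : 0 < ε) {μ : Measure (Rd d)} (hμ : μ ∈ P2 d) :
    ∃ B, 0 ≤ B ∧ ∀ θ, Real.exp (-(B * (1 + ‖θ‖ ^ 2))) ≤ molDensity ε μ θ := by
  have := hμ.1
  set c := Real.log (kern ε (0 : Rd d))
  set m := ∫ y, ‖y‖ ^ 2 ∂μ
  have hm : 0 ≤ m := integral_nonneg fun _ => sq_nonneg _
  refine ⟨|c| + (1 + m) / ε ^ 2, by positivity, fun θ => ?_⟩
  set a := c - (‖θ‖ ^ 2 + m) / ε ^ 2 with ha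
  have hlow : ∀ y, Real.exp a * (1 + (m - ‖y‖ ^ 2) / ε ^ 2) ≤ kern ε (θ - y) := fun y => by
    have h1 : ‖θ - y‖ ^ 2 ≤ 2 * (‖θ‖ ^ 2 + ‖y‖ ^ 2) := by
      have : ‖θ - y‖ ^ 2 ≤ (‖θ‖ + ‖y‖) ^ 2 := by gcongr; exact norm_sub_le _ _
      nlinarith [sq_nonneg (‖θ‖ - ‖y‖)]
    have h2 : a + (m - ‖y‖ ^ 2) / ε ^ 2 ≤ Real.log (kern ε (θ - y)) := by
      rw [log_kern hε]
      have : ‖θ - y‖ ^ 2 / (2 * ε ^ 2) ≤ (‖θ‖ ^ 2 + ‖y‖ ^ 2) / ε ^ 2 := by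
        rw [div_le_div_iff₀ (by positivity) (by positivity)]
        nlinarith [sq_pos_of_pos hε]
      have e : a + (m - ‖y‖ ^ 2) / ε ^ 2 = c - (‖θ‖ ^ 2 + ‖y‖ ^ 2) / ε ^ 2 := by
        rw [ha]; ring
      rw [e]; linarith
    rw [← Real.exp_log (kern_pos hε (θ - y))]
    refine le_trans ?_ (Real.exp_le_exp.2 h2)
    rw [Real.exp_add]
    gcongr
    linarith [Real.add_one_le_exp ((m - ‖y‖ ^ 2) / ε ^ 2)]
  have hd : Integrable (fun y => (m - ‖y‖ ^ 2) / ε ^ 2) μ :=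
    ((integrable_const m).sub hμ.2).div_const _
  have hi : Integrable (fun y => Real.exp a * (1 + (m - ‖y‖ ^ 2) / ε ^ 2)) μ :=
    ((integrable_const _).add hd).const_mul _
  have h3 : ∫ y, Real.exp a * (1 + (m - ‖y‖ ^ 2) / ε ^ 2) ∂μ = Real.exp a := by
    rw [integral_const_mul, integral_add (integrable_const _) hd, integral_div,
      integral_sub (integrable_const _) hμ.2]
    simp [m]
  have h4 : Real.exp a ≤ molDensity ε μ θ := by
    rw [← h3]; exact integral_mono hi (integrable_kern_sub_left hε θ) hlow
  refine le_trans (Real.exp_le_exp.2 ?_) h4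
  rw [ha]
  have h5 : (‖θ‖ ^ 2 + m) / ε ^ 2 ≤ (1 + m) / ε ^ 2 * (1 + ‖θ‖ ^ 2) := by
    rw [div_mul_eq_mul_div]
    gcongr
    nlinarith [sq_nonneg ‖θ‖, mul_nonneg hm (sq_nonneg ‖θ‖)]
  nlinarith [neg_abs_le c, mul_nonneg (abs_nonneg c) (sq_nonneg ‖θ‖)]

lemma molDensity_pos (hε : 0 < ε) {μ : Measure (Rd d)} (hμ : μ ∈ P2 d) (θ : Rd d) :
    0 < molDensity ε μ θ := by
  obtain ⟨B, -, hB⟩ := exists_exp_le_molDensity hε hμ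
  exact (Real.exp_pos _).trans_le (hB θ)

lemma quadGrowth_log_molDensity (hε : 0 < ε) {μ : Measure (Rd d)} (hμ : μ ∈ P2 d) :
    QuadGrowth (fun θ => Real.log (molDensity ε μ θ)) := by
  have := hμ.1
  obtain ⟨B, hB0, hB⟩ := exists_exp_le_molDensity hε hμ
  set c := Real.log (kern ε (0 : Rd d))
  refine ⟨(continuous_molDensity hε).log fun θ => (molDensity_pos hε hμ θ).ne', |c| + B,
    by positivity, fun θ => abs_le.2 ⟨?_, ?_⟩⟩
  · have := (Real.le_log_iff_exp_le (molDensity_pos hε hμ θ)).2 (hB θ)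
    nlinarith [mul_nonneg (abs_nonneg c) (sq_nonneg ‖θ‖), abs_nonneg c]
  · have := Real.log_le_log (molDensity_pos hε hμ θ) (molDensity_le hε θ)
    nlinarith [mul_nonneg (abs_nonneg c) (sq_nonneg ‖θ‖), le_abs_self c,
      mul_nonneg hB0 (sq_nonneg ‖θ‖)]

lemma integrable_molMeasure_iff (hε : 0 < ε) {μ : Measure (Rd d)} [IsFiniteMeasure μ]
    {g : Rd d → ℝ} :
    Integrable g (molMeasure ε μ) ↔ Integrable (fun θ => molDensity ε μ θ * g θ) := by
  rw [molMeasure, integrable_withDensity_iff_integrable_smul'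
    (continuous_molDensity hε).measurable.ennreal_ofReal (ae_of_all _ fun _ => ENNReal.ofReal_lt_top)]
  simp only [ENNReal.toReal_ofReal (molDensity_nonneg hε μ _), smul_eq_mul]

lemma integral_molMeasure (hε : 0 < ε) {μ : Measure (Rd d)} [IsFiniteMeasure μ]
    (g : Rd d → ℝ) :
    ∫ θ, g θ ∂(molMeasure ε μ) = ∫ θ, molDensity ε μ θ * g θ := by
  rw [molMeasure, integral_withDensity_eq_integral_toReal_smul
    (continuous_molDensity hε).measurable.ennreal_ofReal (ae_of_all _ fun _ => ENNReal.ofReal_lt_top)]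
  simp only [ENNReal.toReal_ofReal (molDensity_nonneg hε μ _), smul_eq_mul]

lemma integrable_molDensity (hε : 0 < ε) {μ : Measure (Rd d)} (hμ : μ ∈ P2 d) :
    Integrable (molDensity ε μ) := by
  simpa using integrable_molDensity_mul (quadGrowth_const 1) hε hμ

lemma integral_molDensity (hε : 0 < ε) {μ : Measure (Rd d)} (hμ : μ ∈ P2 d) :
    ∫ θ, molDensity ε μ θ = 1 := by
  have := hμ.1
  simpa [conv_const hε] using integral_molDensity_mul (quadGrowth_const 1) hε hμ

lemma mollifiedKL_eq (hε : 0 < ε) {V : Rd d → ℝ} (hV : QuadGrowth V) {μ : Measure (Rd d)}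
    (hμ : μ ∈ P2 d) :
    mollifiedKL V ε μ =
      ∫ θ, molDensity ε μ θ * (V θ + Real.log (molDensity ε μ θ)) := by
  have := hμ.1
  rw [mollifiedKL, integral_molMeasure hε, integral_molMeasure hε, ← integral_add
    (integrable_molDensity_mul hV hε hμ)
    (integrable_molDensity_mul (quadGrowth_log_molDensity hε hμ) hε hμ)]
  simp only [mul_add]

lemma firstVar_eq (hε : 0 < ε) {V : Rd d → ℝ} (hV : QuadGrowth V) {μ : Measure (Rd d)}
    (hμ : μ ∈ P2 d) (w : Rd d) :
    firstVar V ε μ w = conv ε (fun θ => V θ + (Real.log (molDensity ε μ θ) + 1)) w := by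
  rw [conv_add hV ((quadGrowth_log_molDensity hε hμ).add (quadGrowth_const 1)) hε]
  rfl

/-- The lower bound on the mollified relative entropy. -/
lemma neg_log_le_mollifiedKL (hε : 0 < ε) {V : Rd d → ℝ} (hV : QuadGrowth V)
    (hZ : Integrable (fun x => Real.exp (-V x))) {μ : Measure (Rd d)} (hμ : μ ∈ P2 d) :
    -Real.log (∫ x, Real.exp (-V x)) ≤ mollifiedKL V ε μ := by
  set Z := ∫ x, Real.exp (-V x) with hZdef
  have hZ0 : 0 < Z := integral_exp_pos hZ
  have hG := (hV.add (quadGrowth_log_molDensity hε hμ))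
  have hp := integrable_molDensity hε hμ
  -- Gibbs' inequality pointwise: log t ≤ t - 1 at t = e^{-V} / (Z p), multiplied by p. The left
  -- side integrates to 1 - 1 = 0.
  have key : ∀ θ, molDensity ε μ θ - Real.exp (-V θ) / Z ≤
      molDensity ε μ θ * (V θ + Real.log (molDensity ε μ θ)) + molDensity ε μ θ * Real.log Z := by
    intro θ
    have h0 := molDensity_pos hε hμ θ
    have h1 := Real.log_le_sub_one_of_pos (x := Real.exp (-V θ) / Z / molDensity ε μ θ)
      (by positivity)
    rw [Real.log_div (by positivity) h0.ne', Real.log_div (Real.exp_pos _).ne' hZ0.ne',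
      Real.log_exp] at h1
    have h2 := mul_le_mul_of_nonneg_left h1 h0.le
    rw [mul_sub (molDensity ε μ θ) (_ / _), mul_div_cancel₀ _ h0.ne'] at h2
    linarith
  have h3 := integral_mono (hp.sub (hZ.div_const Z))
    ((integrable_molDensity_mul hG hε hμ).add (hp.mul_const (Real.log Z))) key
  rw [integral_add' (integrable_molDensity_mul hG hε hμ) (hp.mul_const (Real.log Z)),
    integral_sub' hp (hZ.div_const Z), integral_div, integral_mul_const,
    integral_molDensity hε hμ, ← hZdef, div_self hZ0.ne', ← mollifiedKL_eq hε hV hμ] at h3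
  linarith

/-! ### The first variation -/

lemma mixture_mem_P2 {μ ν : Measure (Rd d)} (hν : ν ∈ P2 d) (hμ : μ ∈ P2 d) {s : ℝ} (hs0 : 0 ≤ s)
    (hs1 : s ≤ 1) : ENNReal.ofReal (1 - s) • ν + ENNReal.ofReal s • μ ∈ P2 d := by
  have := hμ.1
  have := hν.1
  refine ⟨⟨?_⟩, (hν.2.smul_measure ENNReal.ofReal_ne_top).add_measure
    (hμ.2.smul_measure ENNReal.ofReal_ne_top)⟩
  simp only [Measure.coe_add, Measure.coe_smul, Pi.add_apply, Pi.smul_apply, measure_univ,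
    smul_eq_mul, mul_one]
  rw [← ENNReal.ofReal_add (by linarith) hs0]
  simp

lemma molDensity_mixture (hε : 0 < ε) {μ ν : Measure (Rd d)} [IsFiniteMeasure μ]
    [IsFiniteMeasure ν] {s : ℝ} (hs0 : 0 ≤ s) (hs1 : s ≤ 1) (θ : Rd d) :
    molDensity ε (ENNReal.ofReal (1 - s) • ν + ENNReal.ofReal s • μ) θ =
      molDensity ε ν θ + s * (molDensity ε μ θ - molDensity ε ν θ) := by
  rw [molDensity, integral_add_measure
    ((integrable_kern_sub_left hε θ).smul_measure ENNReal.ofReal_ne_top)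
    ((integrable_kern_sub_left hε θ).smul_measure ENNReal.ofReal_ne_top),
    integral_smul_measure, integral_smul_measure, ENNReal.toReal_ofReal (by linarith),
    ENNReal.toReal_ofReal hs0]
  simp only [molDensity, smul_eq_mul]
  ring

lemma mul_log_sub_le_of_segment {a b s : ℝ} (ha : 0 < a) (hb : 0 < b) (hs0 : 0 < s) (hs1 : s ≤ 1) :
    ((a + s * (b - a)) * Real.log (a + s * (b - a)) - a * Real.log a) / s ≤
      b * Real.log b - a * Real.log a := by
  rw [div_le_iff₀ hs0]
  have := Real.convexOn_mul_log.2 (Set.mem_Ici.2 ha.le) (Set.mem_Ici.2 hb.le)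
    (sub_nonneg.2 hs1) hs0.le (by ring)
  simp only [smul_eq_mul] at this
  rw [show (1 - s) * a + s * b = a + s * (b - a) by ring] at this
  linarith

lemma sub_mul_log_add_one_le {a b : ℝ} (ha : 0 < a) (hb : 0 < b) :
    (b - a) * (Real.log a + 1) ≤ b * Real.log b - a * Real.log a := by
  have h1 := Real.log_le_sub_one_of_pos (x := a / b) (by positivity)
  rw [Real.log_div ha.ne' hb.ne'] at h1
  have h2 := mul_le_mul_of_nonneg_left h1 hb.le
  rw [mul_sub b (a / b), mul_div_cancel₀ _ hb.ne'] at h2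
  linarith

lemma le_mul_log_sub_of_segment {a b s : ℝ} (ha : 0 < a) (hb : 0 < b) (hs0 : 0 < s)
    (hs1 : s ≤ 1) :
    (b - a) * (Real.log a + 1) ≤
      ((a + s * (b - a)) * Real.log (a + s * (b - a)) - a * Real.log a) / s := by
  rw [le_div_iff₀ hs0]
  have hpos : 0 < a + s * (b - a) := by nlinarith
  have := sub_mul_log_add_one_le ha hpos
  linarith

lemma tendsto_mul_log_slope {a : ℝ} (ha : 0 < a) (b : ℝ) :
    Tendsto (fun s : ℝ => ((a + s * (b - a)) * Real.log (a + s * (b - a)) - a * Real.log a) / s)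
      (𝓝[>] 0) (𝓝 ((b - a) * (Real.log a + 1))) := by
  have h1 : HasDerivAt (fun s : ℝ => a + s * (b - a)) (b - a) 0 := by
    simpa using ((hasDerivAt_id (0 : ℝ)).mul_const (b - a)).const_add a
  have h2 : HasDerivAt (fun x => x * Real.log x) (Real.log a + 1) (a + 0 * (b - a)) := by
    simpa using Real.hasDerivAt_mul_log ha.ne'
  have h3 := (HasDerivAt.comp (0 : ℝ) h2 h1).tendsto_slope_zero_right
  rw [mul_comm (b - a) (Real.log a + 1)]
  refine h3.congr fun s => ?_
  simp only [Function.comp, zero_add, zero_mul, add_zero, smul_eq_mul]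
  rw [div_eq_inv_mul]

lemma QuadGrowth.firstVar_integrand {V : Rd d → ℝ} (hV : QuadGrowth V) (hε : 0 < ε)
    {μ : Measure (Rd d)} (hμ : μ ∈ P2 d) :
    QuadGrowth (fun θ => V θ + (Real.log (molDensity ε μ θ) + 1)) :=
  hV.add ((quadGrowth_log_molDensity hε hμ).add (quadGrowth_const 1))

lemma integrable_firstVar (hε : 0 < ε) {V : Rd d → ℝ} (hV : QuadGrowth V)
    {μ ν : Measure (Rd d)} (hν : ν ∈ P2 d) (hμ : μ ∈ P2 d) : Integrable (firstVar V ε ν) μ := by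
  rw [funext (firstVar_eq hε hV hν)]
  exact integrable_conv (hV.firstVar_integrand hε hν) hε hμ

lemma integral_firstVar (hε : 0 < ε) {V : Rd d → ℝ} (hV : QuadGrowth V)
    {μ ν : Measure (Rd d)} (hν : ν ∈ P2 d) (hμ : μ ∈ P2 d) :
    ∫ w, firstVar V ε ν w ∂μ =
      ∫ θ, molDensity ε μ θ * (V θ + (Real.log (molDensity ε ν θ) + 1)) := by
  rw [funext (firstVar_eq hε hV hν)]
  exact (integral_molDensity_mul (hV.firstVar_integrand hε hν) hε hμ).symm

/-- `firstVar V ε ν` is the first variation of the mollified relative entropy at `ν`. -/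
lemma isFirstVariation_firstVar (hε : 0 < ε) {V : Rd d → ℝ} (hV : QuadGrowth V)
    {ν : Measure (Rd d)} (hν : ν ∈ P2 d) :
    IsFirstVariation (mollifiedKL V ε) ν (firstVar V ε ν) := by
  refine ⟨integrable_firstVar hε hV hν hν, fun μ hμ => ⟨integrable_firstVar hε hV hν hμ, ?_⟩⟩
  have := hμ.1
  have := hν.1
  have hgν := hV.firstVar_integrand hε hν
  rw [integral_firstVar hε hV hν hμ, integral_firstVar hε hV hν hν,
    ← integral_sub (integrable_molDensity_mul hgν hε hμ) (integrable_molDensity_mul hgν hε hν)]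
  set p := molDensity ε ν with hp
  set q := molDensity ε μ with hq
  have hp0 : ∀ θ, 0 < p θ := molDensity_pos hε hν
  have hq0 : ∀ θ, 0 < q θ := molDensity_pos hε hμ
  -- The difference quotient of the integrand. The potential term is affine in `s`, so its quotient
  -- does not depend on `s`.
  set f : ℝ → Rd d → ℝ := fun s θ => (q θ - p θ) * V θ +
    ((p θ + s * (q θ - p θ)) * Real.log (p θ + s * (q θ - p θ)) - p θ * Real.log (p θ)) / s with hf
  have hlog := quadGrowth_log_molDensity hε hν
  have hquot : ∀ s ∈ Set.Ioc (0 : ℝ) 1, f s = fun θ =>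
      (molDensity ε (ENNReal.ofReal (1 - s) • ν + ENNReal.ofReal s • μ) θ * (V θ + Real.log
      (molDensity ε (ENNReal.ofReal (1 - s) • ν + ENNReal.ofReal s • μ) θ)) -
        p θ * (V θ + Real.log (p θ))) / s := by
    rintro s ⟨hs0, hs1⟩
    funext θ
    rw [molDensity_mixture hε hs0.le hs1, hf, ← hp, ← hq]
    field_simp
    ring
  have hi : ∀ s ∈ Set.Ioc (0 : ℝ) 1, Integrable (f s) ∧ ∫ θ, f s θ =
      (mollifiedKL V ε (ENNReal.ofReal (1 - s) • ν + ENNReal.ofReal s • μ) -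
        mollifiedKL V ε ν) / s := by
    rintro s ⟨hs0, hs1⟩
    have hm := mixture_mem_P2 hν hμ hs0.le hs1
    have h1 := integrable_molDensity_mul (hV.add (quadGrowth_log_molDensity hε hm)) hε hm
    have h2 := integrable_molDensity_mul (hV.add hlog) hε hν
    rw [hquot s ⟨hs0, hs1⟩]
    refine ⟨(h1.sub h2).div_const s, ?_⟩
    rw [integral_div, integral_sub h1 h2, mollifiedKL_eq hε hV hm, mollifiedKL_eq hε hV hν]
  have hmem : Set.Ioc (0 : ℝ) 1 ∈ 𝓝[>] (0 : ℝ) := Ioc_mem_nhdsGT one_pos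
  refine Tendsto.congr' (f₁ := fun s => ∫ θ, f s θ)
    (by filter_upwards [hmem] with s hs using (hi s hs).2) ?_
  -- By convexity of t log t, its quotient lies between the tangent slope at 0 and the chord slope
  -- over [0, 1]; both are integrable and independent of `s`.
  refine tendsto_integral_filter_of_dominated_convergence
    (fun θ => |(q θ - p θ) * V θ| + (|q θ * Real.log (q θ) - p θ * Real.log (p θ)| +
      |(q θ - p θ) * (Real.log (p θ) + 1)|))
    (by filter_upwards [hmem] with s hs using (hi s hs).1.aestronglyMeasurable) ?_ ?_ ?_
  · filter_upwards [hmem] with s hs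
    refine ae_of_all _ fun θ => (abs_add_le _ _).trans (add_le_add_right ?_ _)
    have hup := mul_log_sub_le_of_segment (hp0 θ) (hq0 θ) hs.1 hs.2
    have hlo := le_mul_log_sub_of_segment (hp0 θ) (hq0 θ) hs.1 hs.2
    have h1 := le_abs_self (q θ * Real.log (q θ) - p θ * Real.log (p θ))
    have h2 := neg_abs_le ((q θ - p θ) * (Real.log (p θ) + 1))
    have h3 := abs_nonneg (q θ * Real.log (q θ) - p θ * Real.log (p θ))
    have h4 := abs_nonneg ((q θ - p θ) * (Real.log (p θ) + 1))
    exact abs_le.2 ⟨by linarith, by linarith⟩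
  · have hsub : ∀ {g : Rd d → ℝ}, QuadGrowth g → Integrable fun θ => (q θ - p θ) * g θ := by
      intro g hg
      simp only [sub_mul]
      exact (integrable_molDensity_mul hg hε hμ).sub (integrable_molDensity_mul hg hε hν)
    exact (hsub hV).abs.add ((((integrable_molDensity_mul (quadGrowth_log_molDensity hε hμ) hε
      hμ).sub (integrable_molDensity_mul hlog hε hν)).abs).add
      (hsub (hlog.add (quadGrowth_const 1))).abs)
  · refine ae_of_all _ fun θ => ?_
    have := (tendsto_mul_log_slope (hp0 θ) (q θ)).const_add ((q θ - p θ) * V θ)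
    convert this using 2
    ring

/-! ### Smoothness and convolution -/

lemma hasFDerivAt_conv (hε : 0 < ε) {G : Rd d → ℝ} (hG : QuadGrowth G) (hd : Differentiable ℝ G)
    {A : ℝ} (hA : 0 ≤ A) (hGA : ∀ x, ‖fderiv ℝ G x‖ ≤ A * (1 + ‖x‖ ^ 2)) (w : Rd d) :
    Integrable (fun z => kern ε z • fderiv ℝ G (z + w)) ∧
    HasFDerivAt (conv ε G) (∫ z, kern ε z • fderiv ℝ G (z + w)) w := by
  rw [funext (conv_eq G)]
  set bound : Rd d → ℝ := fun z => kern ε z * (1 + ‖z‖ ^ 2) * (A * (2 + 2 * (‖w‖ + 1) ^ 2))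
  have hb : Integrable bound := (integrable_kern_mul_one_add_sq hε).mul_const _
  have hm : AEStronglyMeasurable (fun z => kern ε z • fderiv ℝ G (z + w)) volume :=
    (continuous_kern.measurable.smul
      ((measurable_fderiv ℝ G).comp (measurable_add_const w))).aestronglyMeasurable
  have hle : ∀ z, ∀ x ∈ Metric.ball w 1, ‖kern ε z • fderiv ℝ G (z + x)‖ ≤ bound z := by
    intro z x hx
    change _ ≤ kern ε z * (1 + ‖z‖ ^ 2) * (A * (2 + 2 * (‖w‖ + 1) ^ 2))
    rw [norm_smul, Real.norm_of_nonneg (kern_pos hε z).le, mul_assoc]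
    refine mul_le_mul_of_nonneg_left ((hGA _).trans ?_) (kern_pos hε z).le
    have h0 : ‖x‖ ≤ ‖w‖ + 1 := by
      have := norm_le_norm_add_norm_sub' x w
      rw [← dist_eq_norm] at this
      linarith [Metric.mem_ball.1 hx]
    have h1 : ‖z + x‖ ^ 2 ≤ (‖z‖ + (‖w‖ + 1)) ^ 2 := by
      gcongr; exact (norm_add_le _ _).trans (by linarith)
    have h2 : 1 + ‖z + x‖ ^ 2 ≤ (1 + ‖z‖ ^ 2) * (2 + 2 * (‖w‖ + 1) ^ 2) := by
      nlinarith [sq_nonneg (‖z‖ - (‖w‖ + 1)), mul_nonneg (sq_nonneg ‖z‖) (sq_nonneg (‖w‖ + 1))]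
    calc A * (1 + ‖z + x‖ ^ 2) ≤ A * ((1 + ‖z‖ ^ 2) * (2 + 2 * (‖w‖ + 1) ^ 2)) := by gcongr
      _ = _ := by ring
  refine ⟨hb.mono' hm (ae_of_all _ fun z => hle z w (Metric.mem_ball_self one_pos)), ?_⟩
  refine hasFDerivAt_integral_of_dominated_of_fderiv_le (Metric.ball_mem_nhds w one_pos)
    (Eventually.of_forall fun x => ((hG.comp_add x).integrable_kern_mul hε).aestronglyMeasurable)
    ((hG.comp_add w).integrable_kern_mul hε) hm (ae_of_all _ hle) hb
    (ae_of_all _ fun z x _ => ?_)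
  have h1 : HasFDerivAt (fun x => G (z + x)) (fderiv ℝ G (z + x)) x :=
    (hd (z + x)).hasFDerivAt.comp x ((hasFDerivAt_id x).const_add z)
  exact h1.const_mul (kern ε z)

/-- The bound is averaged over translates with weights of total mass 1, so the constant survives
unchanged. No sign of `C` is needed. -/
lemma conv_add_le (hε : 0 < ε) {G : Rd d → ℝ} (hG : QuadGrowth G) (hd : Differentiable ℝ G)
    {A : ℝ} (hA : 0 ≤ A) (hGA : ∀ x, ‖fderiv ℝ G x‖ ≤ A * (1 + ‖x‖ ^ 2)) {C : ℝ}
    (hC : ∀ x u, G (x + u) ≤ G x + fderiv ℝ G x u + C / 2 * ‖u‖ ^ 2) (w u : Rd d) :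
    conv ε G (w + u) ≤ conv ε G w + fderiv ℝ (conv ε G) w u + C / 2 * ‖u‖ ^ 2 := by
  obtain ⟨hi, hf⟩ := hasFDerivAt_conv hε hG hd hA hGA w
  rw [hf.fderiv, ContinuousLinearMap.integral_apply hi, conv_eq, conv_eq]
  have hi' := hi.apply_continuousLinearMap u
  have h1 := (hG.comp_add w).integrable_kern_mul hε
  have h3 : Integrable (fun z : Rd d => kern ε z * (C / 2 * ‖u‖ ^ 2)) :=
    (integrable_kern hε).mul_const _
  have h4 : C / 2 * ‖u‖ ^ 2 = ∫ z : Rd d, kern ε z * (C / 2 * ‖u‖ ^ 2) := by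
    rw [integral_mul_const, integral_kern hε, one_mul]
  have h5 := integral_add' (h1.add hi') h3
  rw [integral_add' h1 hi'] at h5
  rw [h4, ← h5]
  refine integral_mono ((hG.comp_add (w + u)).integrable_kern_mul hε) ((h1.add hi').add h3)
    fun z => ?_
  simp only [Pi.add_apply, smul_apply, smul_eq_mul, ← mul_add]
  refine mul_le_mul_of_nonneg_left ?_ (kern_pos hε z).le
  rw [← add_assoc]
  exact hC _ _

lemma norm_fderiv_sub_fderiv (V : Rd d → ℝ) (x y : Rd d) :
    ‖fderiv ℝ V x - fderiv ℝ V y‖ = ‖gradient V x - gradient V y‖ := by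
  rw [gradient, gradient, ← map_sub, LinearIsometryEquiv.norm_map]

lemma norm_fderiv_le_of_lipschitz_gradient {V : Rd d → ℝ} {L : ℝ} (hL : 0 ≤ L)
    (hLip : ∀ x y, ‖gradient V x - gradient V y‖ ≤ L * ‖x - y‖) (x : Rd d) :
    ‖fderiv ℝ V x‖ ≤ (‖fderiv ℝ V 0‖ + L) * (1 + ‖x‖ ^ 2) := by
  have h1 := hLip x 0
  rw [← norm_fderiv_sub_fderiv, sub_zero] at h1
  have h2 := norm_le_norm_add_norm_sub' (fderiv ℝ V x) (fderiv ℝ V 0)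
  have h3 : ‖x‖ ≤ 1 + ‖x‖ ^ 2 := by nlinarith [sq_nonneg (‖x‖ - 1)]
  have h4 := mul_le_mul_of_nonneg_left h3 hL
  nlinarith [mul_nonneg (norm_nonneg (fderiv ℝ V 0)) (sq_nonneg ‖x‖)]

lemma le_add_fderiv_of_lipschitz_gradient {V : Rd d → ℝ} {L : ℝ} (hV : Differentiable ℝ V)
    (hLip : ∀ x y, ‖gradient V x - gradient V y‖ ≤ L * ‖x - y‖) (x u : Rd d) :
    V (x + u) ≤ V x + fderiv ℝ V x u + L / 2 * ‖u‖ ^ 2 := by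
  have hφ : ∀ t : ℝ, HasDerivAt
      (fun t : ℝ => V (x + t • u) - t * fderiv ℝ V x u - L / 2 * ‖u‖ ^ 2 * t ^ 2)
      (fderiv ℝ V (x + t • u) u - fderiv ℝ V x u - L * ‖u‖ ^ 2 * t) t := by
    intro t
    have h1 : HasDerivAt (fun t : ℝ => x + t • u) u t := by
      simpa using ((hasDerivAt_id t).smul_const u).const_add x
    have h2 := (hV (x + t • u)).hasFDerivAt.comp_hasDerivAt t h1
    have h3 := (h2.sub ((hasDerivAt_id t).mul_const (fderiv ℝ V x u))).sub
      ((hasDerivAt_pow 2 t).const_mul (L / 2 * ‖u‖ ^ 2))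
    refine h3.congr_deriv ?_
    simp only [Nat.cast_ofNat, one_mul, Nat.add_one_sub_one, pow_one]
    ring
  -- The gap between V and its quadratic majorant along the segment is nonincreasing; comparing t =
  -- 0 and t = 1 gives the claim.
  have hanti := antitoneOn_of_deriv_nonpos (convex_Icc (0 : ℝ) 1)
    (fun t _ => (hφ t).continuousAt.continuousWithinAt)
    (fun t _ => (hφ t).differentiableAt.differentiableWithinAt) (fun t ht => ?_)
  · have := hanti (Set.left_mem_Icc.2 zero_le_one) (Set.right_mem_Icc.2 zero_le_one) zero_le_one
    simp only [one_smul, zero_smul, add_zero, one_mul, zero_mul] at this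
    linarith
  · rw [interior_Icc] at ht
    rw [(hφ t).deriv]
    have h1 := (fderiv ℝ V (x + t • u) - fderiv ℝ V x).le_opNorm u
    have h2 := hLip (x + t • u) x
    rw [← norm_fderiv_sub_fderiv, add_sub_cancel_left, norm_smul, Real.norm_of_nonneg ht.1.le] at h2
    have h3 := (le_abs_self _).trans (h1.trans (mul_le_mul_of_nonneg_right h2 (norm_nonneg u)))
    rw [sub_apply] at h3
    linarith

lemma quadGrowth_of_lipschitz_gradient {V : Rd d → ℝ} {L : ℝ} (hL : 0 ≤ L)
    (hV : Differentiable ℝ V) (hLip : ∀ x y, ‖gradient V x - gradient V y‖ ≤ L * ‖x - y‖) :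
    QuadGrowth V := by
  set B := ‖fderiv ℝ V 0‖
  have hB : 0 ≤ B := norm_nonneg _
  refine ⟨hV.continuous, |V 0| + B + L, by positivity, fun x => ?_⟩
  have h1 : ‖V x - V 0‖ ≤ (B + L * ‖x‖) * ‖x - 0‖ := by
    -- Mean value inequality on the ball of radius `‖x‖`, where the derivative is at most `B + L *
    -- ‖x‖`.
    refine (convex_closedBall (0 : Rd d) ‖x‖).norm_image_sub_le_of_norm_fderiv_le
      (𝕜 := ℝ) (fun y _ => hV y) (fun y hy => ?_) (by simp) (by simp)
    have h1 := hLip y 0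
    rw [← norm_fderiv_sub_fderiv, sub_zero] at h1
    have h2 := norm_le_norm_add_norm_sub' (fderiv ℝ V y) (fderiv ℝ V 0)
    have h3 := mul_le_mul_of_nonneg_left (mem_closedBall_zero_iff.1 hy) hL
    linarith
  rw [sub_zero, Real.norm_eq_abs] at h1
  have h2 := abs_sub_abs_le_abs_sub (V x) (V 0)
  have h3 : ‖x‖ ≤ 1 + ‖x‖ ^ 2 := by nlinarith [sq_nonneg (‖x‖ - 1)]
  nlinarith [mul_le_mul_of_nonneg_left h3 hB, mul_nonneg (abs_nonneg (V 0)) (sq_nonneg ‖x‖)]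

/-! ### Empirical measures -/

lemma integral_empirical (x : Fin n → Rd d) (f : Rd d → ℝ) :
    ∫ w, f w ∂(empirical x) = (n : ℝ)⁻¹ * ∑ i, f (x i) := by
  rw [empirical, integral_smul_measure, integral_finsetSum_measure
    fun i _ => integrable_dirac (by simp)]
  simp

lemma empirical_mem_P2 (hn : 1 ≤ n) (x : Fin n → Rd d) : empirical x ∈ P2 d := by
  have hn' : (n : ENNReal) ≠ 0 := by simp; omega
  refine ⟨⟨?_⟩, ?_⟩
  · simp [empirical, ENNReal.inv_mul_cancel hn' (ENNReal.natCast_ne_top n)]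
  · exact (integrable_finsetSum_measure.2 fun i _ => integrable_dirac (by simp)).smul_measure
      (ENNReal.inv_ne_top.2 hn')

lemma map_empirical (x : Fin n → Rd d) {f : Rd d → Rd d} (hf : Measurable f) :
    (empirical x).map f = empirical (fun i => f (x i)) := by
  rw [empirical, Measure.map_smul, Measure.map_finset_sum hf.aemeasurable]
  simp only [Measure.map_dirac' hf]
  rfl

lemma measurable_wassGrad (V : Rd d → ℝ) (μ : Measure (Rd d)) : Measurable (wassGrad V ε μ) :=
  (LinearIsometryEquiv.continuous _).measurable.comp (measurable_fderiv ℝ _)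

lemma molDensity_empirical (x : Fin n → Rd d) (θ : Rd d) :
    molDensity ε (empirical x) θ = (n : ℝ)⁻¹ * ∑ i, kern ε (θ - x i) :=
  integral_empirical x _

/-- One term of a sum of squares is at most the whole sum. This is where the number of particles
enters K. -/
lemma norm_le_of_integral_empirical (hn : 1 ≤ n) {x : Fin n → Rd d} {h : ℝ}
    (hx : ∫ w, ‖w‖ ^ 2 ∂(empirical x) < h) (i : Fin n) : ‖x i‖ ≤ √(n * h) := by
  rw [integral_empirical] at hx
  have hn' : (0 : ℝ) < n := by exact_mod_cast hn
  rw [inv_mul_lt_iff₀ hn'] at hx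
  refine Real.le_sqrt_of_sq_le (le_trans ?_ hx.le)
  exact Finset.single_le_sum (f := fun i => ‖x i‖ ^ 2) (fun _ _ => sq_nonneg _)
    (Finset.mem_univ i)

/-! ### The logarithm of a Gaussian mixture -/

/-- Hoeffding's lemma for a finite weighted sum. -/
lemma log_sum_mul_exp_le {w Z : Fin n → ℝ} (hw : ∀ i, 0 ≤ w i) (hw1 : ∑ i, w i = 1)
    {a b : ℝ} (hZ : ∀ i, Z i ∈ Set.Icc a b) :
    Real.log (∑ i, w i * Real.exp (Z i)) ≤ ∑ i, w i * Z i + (b - a) ^ 2 / 8 := by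
  set P : PMF (Fin n) := PMF.ofFintype (fun i => ENNReal.ofReal (w i)) (by
    rw [← ENNReal.ofReal_sum_of_nonneg fun i _ => hw i, hw1, ENNReal.ofReal_one])
  have hint : ∀ f : Fin n → ℝ, ∫ i, f i ∂P.toMeasure = ∑ i, w i * f i := fun f => by
    rw [PMF.integral_eq_sum]
    refine Finset.sum_congr rfl fun i _ => ?_
    simp [P, ENNReal.toReal_ofReal (hw i)]
  -- The centred variable is sub-Gaussian with parameter ((b - a) / 2)²; at t = 1 this yields the
  -- exponent (b - a)² / 8.
  have h := (ProbabilityTheory.hasSubgaussianMGF_of_mem_Icc (μ := P.toMeasure) (X := Z)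
    (by fun_prop) (ae_of_all _ hZ)).mgf_le 1
  rw [ProbabilityTheory.mgf, hint] at h
  simp only [hint, one_mul] at h
  set m := ∑ i, w i * Z i with hm
  have h1 : ∑ i, w i * Real.exp (Z i - m) = (∑ i, w i * Real.exp (Z i)) * Real.exp (-m) := by
    rw [Finset.sum_mul]
    exact Finset.sum_congr rfl fun i _ => by rw [sub_eq_add_neg, Real.exp_add, mul_assoc]
  rw [h1, Real.exp_neg, ← div_eq_mul_inv, div_le_iff₀ (Real.exp_pos _), ← Real.exp_add] at h
  have hpos : 0 < ∑ i, w i * Real.exp (Z i) := by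
    refine lt_of_lt_of_le (Real.exp_pos a) ?_
    calc Real.exp a = ∑ i, w i * Real.exp a := by rw [← Finset.sum_mul, hw1, one_mul]
      _ ≤ _ := Finset.sum_le_sum fun i _ =>
        mul_le_mul_of_nonneg_left (Real.exp_le_exp.2 (hZ i).1) (hw i)
  rw [Real.log_le_iff_le_exp hpos]
  refine h.trans_eq ?_
  congr 1
  push_cast
  rw [div_pow, Real.norm_eq_abs, sq_abs]
  ring

lemma hasFDerivAt_kern (hε : 0 < ε) (x : Rd d) :
    HasFDerivAt (kern ε) (kern ε x • (-(ε ^ 2)⁻¹) • innerSL ℝ x) x := by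
  have h1 : HasFDerivAt (fun x : Rd d => -‖x‖ ^ 2 / (2 * ε ^ 2))
      ((2 * ε ^ 2)⁻¹ • -((2 : ℕ) • innerSL ℝ x)) x := by
    have := ((hasStrictFDerivAt_norm_sq x).hasFDerivAt.neg).const_smul ((2 * ε ^ 2)⁻¹)
    refine this.congr_of_eventuallyEq (Eventually.of_forall fun y => ?_)
    simp only [Pi.smul_apply, Pi.neg_apply, smul_eq_mul]
    ring
  refine ((h1.exp).const_mul (((2 * Real.pi * ε ^ 2) ^ ((d : ℝ) / 2))⁻¹)).congr_fderiv ?_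
  ext u
  simp only [kern, smul_apply, neg_apply, nsmul_eq_mul, Nat.cast_ofNat, smul_eq_mul, innerSL_apply_apply]
  field_simp

/-- A translation tilts the kernel by an exponential linear in `z`, up to a factor independent of
`z` that comes out of a mixture. -/
lemma kern_add (hε : 0 < ε) (z u : Rd d) :
    kern ε (z + u) = kern ε z * Real.exp (-(ε ^ 2)⁻¹ * inner ℝ z u) *
      Real.exp (-(‖u‖ ^ 2 / (2 * ε ^ 2))) := by
  rw [kern, kern, norm_add_sq_real, mul_assoc _ (Real.exp _), mul_assoc _ (Real.exp _),
    ← Real.exp_add, ← Real.exp_add]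
  congr 2
  field_simp
  ring

/-- The weights of the conditional law of the component of a Gaussian mixture given its value. -/
noncomputable def postWeight (ε : ℝ) (x : Fin n → Rd d) (θ : Rd d) (i : Fin n) : ℝ :=
  kern ε (θ - x i) / ∑ j, kern ε (θ - x j)

lemma sum_kern_pos (hε : 0 < ε) (hn : 1 ≤ n) (x : Fin n → Rd d) (θ : Rd d) :
    0 < ∑ j, kern ε (θ - x j) := by
  have : Nonempty (Fin n) := ⟨⟨0, hn⟩⟩
  exact Finset.sum_pos (fun _ _ => kern_pos hε _) Finset.univ_nonempty

lemma postWeight_nonneg (hε : 0 < ε) (hn : 1 ≤ n) (x : Fin n → Rd d) (θ : Rd d) (i : Fin n) :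
    0 ≤ postWeight ε x θ i :=
  div_nonneg (kern_pos hε _).le (sum_kern_pos hε hn x θ).le

lemma sum_postWeight (hε : 0 < ε) (hn : 1 ≤ n) (x : Fin n → Rd d) (θ : Rd d) :
    ∑ i, postWeight ε x θ i = 1 := by
  simp only [postWeight, ← Finset.sum_div]
  exact div_self (sum_kern_pos hε hn x θ).ne'

lemma log_molDensity_empirical (hε : 0 < ε) (hn : 1 ≤ n) (x : Fin n → Rd d) (θ : Rd d) :
    Real.log (molDensity ε (empirical x) θ) =
      Real.log (n : ℝ)⁻¹ + Real.log (∑ i, kern ε (θ - x i)) := by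
  rw [molDensity_empirical, Real.log_mul (by simp; omega) (sum_kern_pos hε hn x θ).ne']

lemma hasFDerivAt_log_molDensity_empirical (hε : 0 < ε) (hn : 1 ≤ n) (x : Fin n → Rd d)
    (θ : Rd d) :
    HasFDerivAt (fun θ => Real.log (molDensity ε (empirical x) θ))
      (∑ i, postWeight ε x θ i • (-(ε ^ 2)⁻¹) • innerSL ℝ (θ - x i)) θ := by
  rw [funext (log_molDensity_empirical hε hn x)]
  have h1 : ∀ i, HasFDerivAt (fun θ => kern ε (θ - x i))
      (kern ε (θ - x i) • (-(ε ^ 2)⁻¹) • innerSL ℝ (θ - x i)) θ :=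
    fun i => (hasFDerivAt_kern hε (θ - x i)).comp θ (f := fun θ => θ - x i)
      ((hasFDerivAt_id θ).sub_const (x i))
  have h2 := ((HasFDerivAt.fun_sum fun i (_ : i ∈ Finset.univ) => h1 i).log
    (sum_kern_pos hε hn x θ).ne').const_add (Real.log (n : ℝ)⁻¹)
  refine h2.congr_fderiv ?_
  rw [Finset.smul_sum]
  refine Finset.sum_congr rfl fun i _ => ?_
  rw [postWeight, smul_smul _ (kern ε (θ - x i)), div_eq_inv_mul]

lemma norm_fderiv_log_molDensity_empirical_le (hε : 0 < ε) (hn : 1 ≤ n) {x : Fin n → Rd d}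
    {R : ℝ} (hR : 0 ≤ R) (hx : ∀ i, ‖x i‖ ≤ R) (θ : Rd d) :
    ‖fderiv ℝ (fun θ => Real.log (molDensity ε (empirical x) θ)) θ‖ ≤
      (ε ^ 2)⁻¹ * (1 + R) * (1 + ‖θ‖ ^ 2) := by
  rw [(hasFDerivAt_log_molDensity_empirical hε hn x θ).fderiv]
  have h1 : ‖∑ i, postWeight ε x θ i • (-(ε ^ 2)⁻¹) • innerSL ℝ (θ - x i)‖ ≤
      ∑ i, postWeight ε x θ i * ((ε ^ 2)⁻¹ * (‖θ‖ + R)) := by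
    refine norm_sum_le_of_le _ fun i _ => ?_
    rw [norm_smul, norm_smul, innerSL_apply_norm, norm_neg, Real.norm_of_nonneg
      (postWeight_nonneg hε hn x θ i), Real.norm_of_nonneg (by positivity : 0 ≤ (ε ^ 2)⁻¹)]
    have := postWeight_nonneg hε hn x θ i
    gcongr
    exact (norm_sub_le _ _).trans (by linarith [hx i])
  refine h1.trans ?_
  rw [← Finset.sum_mul, sum_postWeight hε hn, one_mul, mul_assoc]
  refine mul_le_mul_of_nonneg_left ?_ (by positivity)
  nlinarith [sq_nonneg (‖θ‖ - 1), mul_nonneg hR (sq_nonneg ‖θ‖)]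

/-- By `kern_add`, the ratio of the densities at θ + u and θ is e^{-‖u‖²/(2ε²)} times the posterior
mean of e^{Z i}. The `Z i` lie in an interval of length 2R‖u‖/ε², so Hoeffding costs R²‖u‖²/(2ε⁴),
and their posterior mean is the derivative in direction `u`. -/
lemma log_molDensity_empirical_add_le (hε : 0 < ε) (hn : 1 ≤ n) {x : Fin n → Rd d}
    {R : ℝ} (hx : ∀ i, ‖x i‖ ≤ R) (θ u : Rd d) :
    Real.log (molDensity ε (empirical x) (θ + u)) ≤
      Real.log (molDensity ε (empirical x) θ) +
        fderiv ℝ (fun θ => Real.log (molDensity ε (empirical x) θ)) θ u +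
        (R ^ 2 / ε ^ 4 - 1 / ε ^ 2) / 2 * ‖u‖ ^ 2 := by
  rw [(hasFDerivAt_log_molDensity_empirical hε hn x θ).fderiv]
  have hS := sum_kern_pos hε hn x θ
  set Z : Fin n → ℝ := fun i => -(ε ^ 2)⁻¹ * inner ℝ (θ - x i) u with hZ
  have hsum : ∑ i, kern ε (θ + u - x i) =
      (∑ i, kern ε (θ - x i)) * ((∑ i, postWeight ε x θ i * Real.exp (Z i)) *
        Real.exp (-(‖u‖ ^ 2 / (2 * ε ^ 2)))) := by
    rw [← mul_assoc, Finset.mul_sum, Finset.sum_mul]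
    refine Finset.sum_congr rfl fun i _ => ?_
    rw [add_sub_right_comm, kern_add hε, postWeight, ← mul_assoc (Finset.sum _ _),
      mul_div_cancel₀ _ hS.ne']
  have hpos : 0 < ∑ i, postWeight ε x θ i * Real.exp (Z i) := by
    have h1 := sum_kern_pos hε hn x (θ + u)
    rw [hsum] at h1
    exact pos_of_mul_pos_left (pos_of_mul_pos_right h1 hS.le) (Real.exp_pos _).le
  have hZ' : ∀ i, Z i ∈ Set.Icc ((ε ^ 2)⁻¹ * (-(R * ‖u‖) - inner ℝ θ u))
      ((ε ^ 2)⁻¹ * (R * ‖u‖ - inner ℝ θ u)) := by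
    intro i
    have h1 : |inner ℝ (x i) u| ≤ R * ‖u‖ :=
      (abs_real_inner_le_norm _ _).trans (mul_le_mul_of_nonneg_right (hx i) (norm_nonneg u))
    have h2 : Z i = (ε ^ 2)⁻¹ * (inner ℝ (x i) u - inner ℝ θ u) := by
      rw [hZ]; simp only [inner_sub_left]; ring
    rw [h2]
    have h3 : 0 ≤ (ε ^ 2)⁻¹ := by positivity
    exact ⟨mul_le_mul_of_nonneg_left (by linarith [(abs_le.1 h1).1]) h3,
      mul_le_mul_of_nonneg_left (by linarith [(abs_le.1 h1).2]) h3⟩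
  have h := log_sum_mul_exp_le (fun i => postWeight_nonneg hε hn x θ i)
    (sum_postWeight hε hn x θ) hZ'
  have hlin : (∑ i, postWeight ε x θ i • (-(ε ^ 2)⁻¹) • innerSL ℝ (θ - x i)) u =
      ∑ i, postWeight ε x θ i * Z i := by
    simp only [hZ, sum_apply, smul_apply, smul_eq_mul, innerSL_apply_apply]
  rw [hlin, log_molDensity_empirical hε hn, log_molDensity_empirical hε hn, hsum,
    Real.log_mul hS.ne' (by positivity), Real.log_mul hpos.ne' (Real.exp_pos _).ne', Real.log_exp]
  have e : ((ε ^ 2)⁻¹ * (R * ‖u‖ - inner ℝ θ u) - (ε ^ 2)⁻¹ * (-(R * ‖u‖) - inner ℝ θ u)) ^ 2 / 8 -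
      ‖u‖ ^ 2 / (2 * ε ^ 2) = (R ^ 2 / ε ^ 4 - 1 / ε ^ 2) / 2 * ‖u‖ ^ 2 := by
    field_simp
    ring
  linarith

/-! ### Relative entropy of Gaussian mixtures -/

/-- The log-sum inequality. -/
lemma sum_mul_log_sub_log_le {a b : Fin n → ℝ} (hn : 1 ≤ n) (ha : ∀ i, 0 < a i)
    (hb : ∀ i, 0 < b i) :
    (∑ i, a i) * (Real.log (∑ i, a i) - Real.log (∑ i, b i)) ≤
      ∑ i, a i * (Real.log (a i) - Real.log (b i)) := by
  have : Nonempty (Fin n) := ⟨⟨0, hn⟩⟩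
  set A := ∑ i, a i with hA
  set B := ∑ i, b i with hB
  have hA0 : 0 < A := Finset.sum_pos (fun i _ => ha i) Finset.univ_nonempty
  have hB0 : 0 < B := Finset.sum_pos (fun i _ => hb i) Finset.univ_nonempty
  -- Apply log t ≤ t - 1 at t = b i A / (a i B). The corrections a i - b i A / B sum to zero.
  have h1 : ∀ i, a i * (Real.log A - Real.log B) + (a i - b i * (A / B)) ≤
      a i * (Real.log (a i) - Real.log (b i)) := by
    intro i
    have h2 := Real.log_le_sub_one_of_pos (x := b i * A / (a i * B))
      (div_pos (mul_pos (hb i) hA0) (mul_pos (ha i) hB0))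
    rw [Real.log_div (mul_pos (hb i) hA0).ne' (mul_pos (ha i) hB0).ne',
      Real.log_mul (hb i).ne' hA0.ne', Real.log_mul (ha i).ne' hB0.ne'] at h2
    have h3 := mul_le_mul_of_nonneg_left h2 (ha i).le
    have h4 : a i * (b i * A / (a i * B) - 1) = b i * (A / B) - a i := by
      have := (ha i).ne'
      field_simp
    rw [h4] at h3
    linarith
  have h5 := Finset.sum_le_sum fun i (_ : i ∈ Finset.univ) => h1 i
  rw [Finset.sum_add_distrib, Finset.sum_sub_distrib, ← Finset.sum_mul, ← Finset.sum_mul, ← hA,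
    ← hB, mul_div_cancel₀ _ hB0.ne'] at h5
  linarith

lemma quadGrowth_sq_norm_sub (x : Rd d) : QuadGrowth (fun θ => ‖θ - x‖ ^ 2) := by
  simpa only [sub_eq_add_neg] using quadGrowth_sq_norm.comp_add (-x)

lemma integral_kern_mul_inner (hε : 0 < ε) (u : Rd d) :
    Integrable (fun z : Rd d => kern ε z * inner ℝ z u) ∧
      ∫ z, kern ε z * inner ℝ z u = 0 := by
  constructor
  · refine QuadGrowth.integrable_kern_mul ⟨by fun_prop, ‖u‖, norm_nonneg _, fun x => ?_⟩ hε
    refine (abs_real_inner_le_norm _ _).trans ?_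
    rw [mul_comm]
    gcongr
    nlinarith [sq_nonneg (‖x‖ - 1)]
  · have h := integral_neg_eq_self (fun z : Rd d => kern ε z * inner ℝ z u) volume
    simp only [kern_neg, inner_neg_left, mul_neg, integral_neg] at h
    linarith

/-- This is 2ε² times the relative entropy of two Gaussians centred at `y` and `x`. After recentring
at `y`, the cross term vanishes by oddness. -/
lemma integral_kern_mul_sq_norm_sub (hε : 0 < ε) (x y : Rd d) :
    ∫ θ, kern ε (θ - y) * (‖θ - x‖ ^ 2 - ‖θ - y‖ ^ 2) = ‖y - x‖ ^ 2 := by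
  obtain ⟨h1, h2⟩ := integral_kern_mul_inner hε (y - x)
  rw [← integral_add_right_eq_self _ y]
  have h3 : ∀ z : Rd d, kern ε (z + y - y) * (‖z + y - x‖ ^ 2 - ‖z + y - y‖ ^ 2) =
      2 * (kern ε z * inner ℝ z (y - x)) + kern ε z * ‖y - x‖ ^ 2 := by
    intro z
    rw [add_sub_cancel_right, add_sub_assoc, norm_add_sq_real]
    ring
  simp only [h3]
  rw [integral_add (h1.const_mul 2) ((integrable_kern hε).mul_const _), integral_const_mul, h2,
    integral_mul_const, integral_kern hε]
  ring

/-- The log-sum inequality, applied at each θ with `y i` paired to `x i`, bounds the entropy of the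
mixtures by the average over components; the common factor 1/n cancels in the logarithms. -/
lemma integral_molDensity_mul_log_sub_le (hε : 0 < ε) (hn : 1 ≤ n) (x y : Fin n → Rd d) :
    ∫ θ, molDensity ε (empirical y) θ * (Real.log (molDensity ε (empirical y) θ) -
      Real.log (molDensity ε (empirical x) θ)) ≤
    (2 * ε ^ 2)⁻¹ * ((n : ℝ)⁻¹ * ∑ i, ‖y i - x i‖ ^ 2) := by
  have hx := empirical_mem_P2 hn x
  have hy := empirical_mem_P2 hn y
  set g : Fin n → Rd d → ℝ := fun i θ => kern ε (θ - y i) * (‖θ - x i‖ ^ 2 - ‖θ - y i‖ ^ 2) with hg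
  have hgi : ∀ i, Integrable (g i) := fun i => by
    simp only [hg, mul_sub]
    exact ((quadGrowth_sq_norm_sub _).integrable_kern_sub_mul hε _).sub
      ((quadGrowth_sq_norm_sub _).integrable_kern_sub_mul hε _)
  have hR : Integrable (fun θ => (2 * ε ^ 2)⁻¹ * ((n : ℝ)⁻¹ * ∑ i, g i θ)) :=
    ((integrable_finsetSum _ fun i _ => hgi i).const_mul _).const_mul _
  have hLi : Integrable (fun θ => molDensity ε (empirical y) θ *
      (Real.log (molDensity ε (empirical y) θ) - Real.log (molDensity ε (empirical x) θ))) := by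
    simp only [mul_sub]
    exact (integrable_molDensity_mul (quadGrowth_log_molDensity hε hy) hε hy).sub
      (integrable_molDensity_mul (quadGrowth_log_molDensity hε hx) hε hy)
  refine (integral_mono hLi hR fun θ => ?_).trans_eq ?_
  swap
  · rw [integral_const_mul, integral_const_mul, integral_finsetSum _ fun i _ => hgi i]
    simp only [hg, integral_kern_mul_sq_norm_sub hε]
  · simp only [log_molDensity_empirical hε hn]
    rw [molDensity_empirical, add_sub_add_left_eq_sub, mul_assoc, mul_left_comm (2 * ε ^ 2)⁻¹]
    refine mul_le_mul_of_nonneg_left ?_ (by positivity)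
    refine (sum_mul_log_sub_log_le hn (fun i => kern_pos hε _) fun i => kern_pos hε _).trans_eq ?_
    rw [Finset.mul_sum]
    refine Finset.sum_congr rfl fun i _ => ?_
    rw [hg, log_kern hε (θ - y i), log_kern hε (θ - x i)]
    ring

/-! ### Descent -/

/-- The constant 1 in F_ε' integrates to 1. For μ = ν the right side is F_ε itself; otherwise it
differs from F_ε(μ) by a relative entropy. -/
lemma integral_firstVar_sub_one (hε : 0 < ε) {V : Rd d → ℝ} (hV : QuadGrowth V)
    {μ ν : Measure (Rd d)} (hν : ν ∈ P2 d) (hμ : μ ∈ P2 d) :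
    ∫ w, firstVar V ε ν w ∂μ - 1 =
      ∫ θ, molDensity ε μ θ * (V θ + Real.log (molDensity ε ν θ)) := by
  have h := integral_add (integrable_molDensity_mul
    (hV.add (quadGrowth_log_molDensity hε hν)) hε hμ) (integrable_molDensity hε hμ)
  rw [integral_molDensity hε hμ] at h
  rw [integral_firstVar hε hV hν hμ, sub_eq_iff_eq_add, ← h]
  congr 1; funext θ
  ring

section Descent

variable {V : Rd d → ℝ} {L R : ℝ} {x : Fin n → Rd d}

lemma smooth_potential_add_log (hε : 0 < ε) (hn : 1 ≤ n) (hL : 0 ≤ L) (hV : Differentiable ℝ V)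
    (hLip : ∀ x y, ‖gradient V x - gradient V y‖ ≤ L * ‖x - y‖) (hR : 0 ≤ R)
    (hx : ∀ i, ‖x i‖ ≤ R) :
    Differentiable ℝ (fun θ => V θ + (Real.log (molDensity ε (empirical x) θ) + 1)) ∧
    (∃ A, 0 ≤ A ∧ ∀ θ, ‖fderiv ℝ (fun θ => V θ + (Real.log (molDensity ε (empirical x) θ) + 1)) θ‖ ≤
      A * (1 + ‖θ‖ ^ 2)) ∧
    ∀ θ u, V (θ + u) + (Real.log (molDensity ε (empirical x) (θ + u)) + 1) ≤
      V θ + (Real.log (molDensity ε (empirical x) θ) + 1) +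
        fderiv ℝ (fun θ => V θ + (Real.log (molDensity ε (empirical x) θ) + 1)) θ u +
        (L + (R ^ 2 / ε ^ 4 - 1 / ε ^ 2)) / 2 * ‖u‖ ^ 2 := by
  have hlog : Differentiable ℝ (fun θ => Real.log (molDensity ε (empirical x) θ)) :=
    fun θ => (hasFDerivAt_log_molDensity_empirical hε hn x θ).differentiableAt
  have hd : ∀ θ, fderiv ℝ (fun θ => V θ + (Real.log (molDensity ε (empirical x) θ) + 1)) θ =
      fderiv ℝ V θ + fderiv ℝ (fun θ => Real.log (molDensity ε (empirical x) θ)) θ := fun θ =>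
    ((hV θ).hasFDerivAt.add ((hlog θ).hasFDerivAt.add_const 1)).fderiv
  refine ⟨hV.add (hlog.add_const 1),
    ⟨‖fderiv ℝ V 0‖ + L + (ε ^ 2)⁻¹ * (1 + R), ?_, fun θ => ?_⟩, fun θ u => ?_⟩
  · positivity
  · rw [hd, add_mul]
    exact (norm_add_le _ _).trans (add_le_add (norm_fderiv_le_of_lipschitz_gradient hL hLip θ)
      (norm_fderiv_log_molDensity_empirical_le hε hn hR hx θ))
  · rw [hd, add_apply]
    have h1 := le_add_fderiv_of_lipschitz_gradient hV hLip θ u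
    have h2 := log_molDensity_empirical_add_le hε hn hx θ u
    linarith

lemma differentiable_firstVar_empirical (hε : 0 < ε) (hn : 1 ≤ n) (hL : 0 ≤ L)
    (hV : Differentiable ℝ V) (hLip : ∀ x y, ‖gradient V x - gradient V y‖ ≤ L * ‖x - y‖) :
    Differentiable ℝ (firstVar V ε (empirical x)) := by
  have hVq := quadGrowth_of_lipschitz_gradient hL hV hLip
  have hP := empirical_mem_P2 hn x
  -- Differentiability needs only some bound on the particles, so the sum of their norms serves.
  obtain ⟨hd, ⟨A, hA, hGA⟩, -⟩ := smooth_potential_add_log (R := ∑ i, ‖x i‖) (x := x) hε hn hL hV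
    hLip (by positivity)
    fun i => Finset.single_le_sum (f := fun i => ‖x i‖) (fun _ _ => norm_nonneg _)
      (Finset.mem_univ i)
  rw [funext (firstVar_eq hε hVq hP)]
  exact fun w => (hasFDerivAt_conv hε (hVq.firstVar_integrand hε hP) hd hA
    hGA w).2.differentiableAt

lemma firstVar_empirical_add_le (hε : 0 < ε) (hn : 1 ≤ n) (hL : 0 ≤ L) (hV : Differentiable ℝ V)
    (hLip : ∀ x y, ‖gradient V x - gradient V y‖ ≤ L * ‖x - y‖) (hR : 0 ≤ R)
    (hx : ∀ i, ‖x i‖ ≤ R) (w u : Rd d) :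
    firstVar V ε (empirical x) (w + u) ≤ firstVar V ε (empirical x) w +
      inner ℝ (wassGrad V ε (empirical x) w) u +
      (L + (R ^ 2 / ε ^ 4 - 1 / ε ^ 2)) / 2 * ‖u‖ ^ 2 := by
  have hVq := quadGrowth_of_lipschitz_gradient hL hV hLip
  have hP := empirical_mem_P2 hn x
  obtain ⟨hd, ⟨A, hA, hGA⟩, hC⟩ := smooth_potential_add_log hε hn hL hV hLip hR hx
  rw [wassGrad, inner_gradient_left, funext (firstVar_eq hε hVq hP)]
  exact conv_add_le hε (hVq.firstVar_integrand hε hP) hd hA hGA hC w u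

lemma mollifiedKL_empirical_le (hε : 0 < ε) (hn : 1 ≤ n) (hL : 0 ≤ L) (hV : Differentiable ℝ V)
    (hLip : ∀ x y, ‖gradient V x - gradient V y‖ ≤ L * ‖x - y‖) (hR : 0 ≤ R)
    (hx : ∀ i, ‖x i‖ ≤ R) (u : Fin n → Rd d) :
    mollifiedKL V ε (empirical fun i => x i + u i) ≤ mollifiedKL V ε (empirical x) +
      (n : ℝ)⁻¹ * ∑ i, (inner ℝ (wassGrad V ε (empirical x) (x i)) (u i) +
        (L + R ^ 2 / ε ^ 4) / 2 * ‖u i‖ ^ 2) := by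
  have hVq := quadGrowth_of_lipschitz_gradient hL hV hLip
  set y : Fin n → Rd d := fun i => x i + u i with hy
  have hPx := empirical_mem_P2 hn x
  have hPy := empirical_mem_P2 hn y
  have hlx := quadGrowth_log_molDensity hε hPx
  have hly := quadGrowth_log_molDensity hε hPy
  have hnew : mollifiedKL V ε (empirical y) = ∫ w, firstVar V ε (empirical x) w ∂(empirical y) - 1 +
      ∫ θ, molDensity ε (empirical y) θ * (Real.log (molDensity ε (empirical y) θ) -
        Real.log (molDensity ε (empirical x) θ)) := by
    have hsub : Integrable (fun θ => molDensity ε (empirical y) θ *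
        (Real.log (molDensity ε (empirical y) θ) -
          Real.log (molDensity ε (empirical x) θ))) := by
      simp only [mul_sub]
      exact (integrable_molDensity_mul hly hε hPy).sub (integrable_molDensity_mul hlx hε hPy)
    rw [integral_firstVar_sub_one hε hVq hPx hPy, mollifiedKL_eq hε hVq hPy,
      ← integral_add (integrable_molDensity_mul (hVq.add hlx) hε hPy) hsub]
    congr 1; funext θ
    ring
  have hold : mollifiedKL V ε (empirical x) =
      ∫ w, firstVar V ε (empirical x) w ∂(empirical x) - 1 := by
    rw [integral_firstVar_sub_one hε hVq hPx hPx, mollifiedKL_eq hε hVq hPx]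
  have hKL := integral_molDensity_mul_log_sub_le hε hn x y
  have hsum := Finset.sum_le_sum fun i (_ : i ∈ Finset.univ) =>
    firstVar_empirical_add_le hε hn hL hV hLip hR hx (x i) (u i)
  have hn0 : (0 : ℝ) ≤ (n : ℝ)⁻¹ := by positivity
  have hsum' := mul_le_mul_of_nonneg_left hsum hn0
  rw [hnew, hold, integral_empirical, integral_empirical]
  simp only [hy, add_sub_cancel_left] at hKL ⊢
  rw [mul_left_comm] at hKL
  -- The entropy cost 1/(2ε²) cancels the negative curvature term -1/(2ε²) of the log-density.
  have key : (n : ℝ)⁻¹ * ∑ i, (firstVar V ε (empirical x) (x i) +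
        inner ℝ (wassGrad V ε (empirical x) (x i)) (u i) +
        (L + (R ^ 2 / ε ^ 4 - 1 / ε ^ 2)) / 2 * ‖u i‖ ^ 2) +
      (n : ℝ)⁻¹ * ((2 * ε ^ 2)⁻¹ * ∑ i, ‖u i‖ ^ 2) =
      (n : ℝ)⁻¹ * ∑ i, firstVar V ε (empirical x) (x i) +
      (n : ℝ)⁻¹ * ∑ i, (inner ℝ (wassGrad V ε (empirical x) (x i)) (u i) +
        (L + R ^ 2 / ε ^ 4) / 2 * ‖u i‖ ^ 2) := by
    rw [← mul_add, ← mul_add, Finset.mul_sum, ← Finset.sum_add_distrib,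
      ← Finset.sum_add_distrib]
    congr 1
    refine Finset.sum_congr rfl fun i _ => ?_
    rw [one_div, mul_inv]
    ring
  linarith

/-- One step of Wasserstein gradient descent decreases the mollified relative entropy. -/
lemma mollifiedKL_descent (hε : 0 < ε) (hn : 1 ≤ n) (hL : 0 ≤ L) (hV : Differentiable ℝ V)
    (hLip : ∀ x y, ‖gradient V x - gradient V y‖ ≤ L * ‖x - y‖) (hR : 0 ≤ R)
    (hx : ∀ i, ‖x i‖ ≤ R) (γ : ℝ) :
    mollifiedKL V ε (empirical fun i => x i - γ • wassGrad V ε (empirical x) (x i)) +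
      γ * (1 - γ * (L + R ^ 2 / ε ^ 4) / 2) * gradNormSq V ε (empirical x) ≤
    mollifiedKL V ε (empirical x) := by
  have h := mollifiedKL_empirical_le hε hn hL hV hLip hR hx
    fun i => -(γ • wassGrad V ε (empirical x) (x i))
  simp only [← sub_eq_add_neg, inner_neg_right, inner_smul_right, real_inner_self_eq_norm_sq,
    norm_neg, norm_smul, mul_pow, Real.norm_eq_abs, sq_abs] at h
  rw [gradNormSq, integral_empirical]
  have e : (n : ℝ)⁻¹ * ∑ i, (-(γ * ‖wassGrad V ε (empirical x) (x i)‖ ^ 2) +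
      (L + R ^ 2 / ε ^ 4) / 2 * (γ ^ 2 * ‖wassGrad V ε (empirical x) (x i)‖ ^ 2)) =
      -(γ * (1 - γ * (L + R ^ 2 / ε ^ 4) / 2) *
        ((n : ℝ)⁻¹ * ∑ i, ‖wassGrad V ε (empirical x) (x i)‖ ^ 2)) := by
    rw [Finset.mul_sum, Finset.mul_sum, Finset.mul_sum, ← Finset.sum_neg_distrib]
    refine Finset.sum_congr rfl fun i _ => ?_
    ring
  rw [e] at h
  linarith

end Descent

/-! ### Iterating the descent step -/

lemma gradNormSq_nonneg (V : Rd d → ℝ) (μ : Measure (Rd d)) : 0 ≤ gradNormSq V ε μ :=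
  integral_nonneg fun _ => sq_nonneg _

/-- Push-forward moves the atoms and keeps their number. Stating the next step together with the
representation makes both refer to the same particles. -/
lemma IsWassGD.exists_empirical {V : Rd d → ℝ} {γ : ℝ} {μ : ℕ → Measure (Rd d)}
    (hμ : IsWassGD V ε γ μ) {x₀ : Fin n → Rd d} (h0 : μ 0 = empirical x₀) (l : ℕ) :
    ∃ x : Fin n → Rd d, μ l = empirical x ∧
      μ (l + 1) = empirical fun i => x i - γ • wassGrad V ε (μ l) (x i) := by
  have hstep : ∀ (l : ℕ) (x : Fin n → Rd d), μ l = empirical x →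
      μ (l + 1) = empirical fun i => x i - γ • wassGrad V ε (μ l) (x i) := by
    intro l x hx
    have hm : Measurable (fun w => w - γ • wassGrad V ε (μ l) w) :=
      measurable_id.sub ((measurable_wassGrad V (μ l)).const_smul γ)
    rw [hμ l, ← map_empirical x hm, ← hx]
  induction l with
  | zero => exact ⟨x₀, h0, hstep 0 x₀ h0⟩
  | succ l ih =>
    obtain ⟨x, -, hx'⟩ := ih
    exact ⟨_, hx', hstep _ _ hx'⟩

/-- Telescoping the descent inequality `F (l + 1) + c * g l ≤ F l` with `F ≥ m`. -/
lemma sum_range_le_of_descent {F g : ℕ → ℝ} {c m : ℝ} (hF : ∀ l, F (l + 1) + c * g l ≤ F l)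
    (hm : ∀ l, m ≤ F l) (T : ℕ) : c * ∑ l ∈ Finset.range T, g l ≤ F 0 - m := by
  have h : ∀ T, F T + c * ∑ l ∈ Finset.range T, g l ≤ F 0 := by
    intro T
    induction T with
    | zero => simp
    | succ T ih => rw [Finset.sum_range_succ]; linarith [hF T]
  linarith [h T, hm T]

end MollifiedVI

theorem mainTheorem3 (ε : ℝ) (hε : 0 < ε) (n : ℕ) (hn : 1 ≤ n) (h : ℝ) (hh : 0 < h) :
    ∃ K : ℝ, 0 < K ∧
      ∀ (d : ℕ) (V : MollifiedVI.Rd d → ℝ) (L : ℝ), 0 ≤ L →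
        Differentiable ℝ V →
        (∀ x y, ‖gradient V x - gradient V y‖ ≤ L * ‖x - y‖) →
        Integrable (fun x => Real.exp (-V x)) volume →
      ∀ (γ : ℝ), 0 < γ → 0 < γ * (1 - γ * (L + K) / 2) →
      ∀ (x₀ : Fin n → MollifiedVI.Rd d) (μ : ℕ → Measure (MollifiedVI.Rd d)),
        μ 0 = MollifiedVI.empirical x₀ →
        MollifiedVI.IsWassGD V ε γ μ →
        (∀ l, ∫ x, ‖x‖ ^ 2 ∂(μ l) < h) →
        -- `F_ε` is well defined on measures with finite second moment, and bounded below
        (∀ ν ∈ MollifiedVI.P2 d,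
          Integrable V (MollifiedVI.molMeasure ε ν) ∧
          Integrable (fun θ => Real.log (MollifiedVI.molDensity ε ν θ))
            (MollifiedVI.molMeasure ε ν) ∧
          -Real.log (∫ x, Real.exp (-V x)) ≤ MollifiedVI.mollifiedKL V ε ν) ∧
        -- `F_ε'(μ_l)` is the first variation of `F_ε` at `μ_l`, and it is differentiable
        (∀ l, μ l ∈ MollifiedVI.P2 d ∧
          MollifiedVI.IsFirstVariation (MollifiedVI.mollifiedKL V ε) (μ l)
            (MollifiedVI.firstVar V ε (μ l)) ∧
          Differentiable ℝ (MollifiedVI.firstVar V ε (μ l))) ∧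
        -- the bound on the average squared gradient norm
        (∀ T : ℕ, 1 ≤ T →
          (1 / (T : ℝ)) * ∑ l ∈ Finset.Icc 1 T, MollifiedVI.gradNormSq V ε (μ l) ≤
            (MollifiedVI.mollifiedKL V ε (μ 0) - MollifiedVI.infKL V ε) /
              (γ * (1 - γ * (L + K) / 2) * T)) ∧
        Summable (fun l => MollifiedVI.gradNormSq V ε (μ l)) ∧
        Tendsto (fun l => MollifiedVI.gradNormSq V ε (μ l)) atTop (𝓝 0) := by
  open MollifiedVI in
  have hn' : (0 : ℝ) < n := by exact_mod_cast hn
  -- This is R² / ε⁴ for the radius R = √(n h) that contains all particles.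
  refine ⟨n * h / ε ^ 4, by positivity, ?_⟩
  intro d V L hL hV hLip hZ γ hγ hc x₀ μ h0 hGD hmom
  have hVq := quadGrowth_of_lipschitz_gradient hL hV hLip
  choose x hx hx' using hGD.exists_empirical h0
  have hP : ∀ l, μ l ∈ P2 d := fun l => hx l ▸ empirical_mem_P2 hn (x l)
  have hstep : ∀ l, mollifiedKL V ε (μ (l + 1)) +
      γ * (1 - γ * (L + n * h / ε ^ 4) / 2) * gradNormSq V ε (μ l) ≤ mollifiedKL V ε (μ l) := by
    intro l
    have hb := norm_le_of_integral_empirical hn (hx l ▸ hmom l)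
    have := mollifiedKL_descent hε hn hL hV hLip (Real.sqrt_nonneg _) hb γ
    rw [Real.sq_sqrt (by positivity), ← hx l, ← hx' l] at this
    exact this
  have hlow : ∀ ν ∈ P2 d, -Real.log (∫ x, Real.exp (-V x)) ≤ mollifiedKL V ε ν :=
    fun ν hν => neg_log_le_mollifiedKL hε hVq hZ hν
  have hinf : ∀ l, infKL V ε ≤ mollifiedKL V ε (μ l) := fun l =>
    csInf_le ⟨_, by rintro _ ⟨ν, hν, rfl⟩; exact hlow ν hν⟩ ⟨μ l, hP l, rfl⟩
  have hsummable : Summable (fun l => gradNormSq V ε (μ l)) := by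
    refine summable_of_sum_range_le
      (c := (mollifiedKL V ε (μ 0) - infKL V ε) / (γ * (1 - γ * (L + n * h / ε ^ 4) / 2)))
      (fun l => gradNormSq_nonneg V (μ l)) fun T => ?_
    rw [le_div_iff₀ hc, mul_comm]
    exact sum_range_le_of_descent hstep hinf T
  refine ⟨fun ν hν => ?_, fun l => ⟨hP l, isFirstVariation_firstVar hε hVq (hP l), ?_⟩,
    fun T hT => ?_, hsummable, hsummable.tendsto_atTop_zero⟩
  · have := hν.1
    exact ⟨(integrable_molMeasure_iff hε).2 (integrable_molDensity_mul hVq hε hν),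
      (integrable_molMeasure_iff hε).2
        (integrable_molDensity_mul (quadGrowth_log_molDensity hε hν) hε hν), hlow ν hν⟩
  · rw [hx l]
    exact differentiable_firstVar_empirical hε hn hL hV hLip
  · have hT' : (0 : ℝ) < T := by exact_mod_cast hT
    -- The sum runs over 1, ..., T, so the telescoping starts at `μ 1`; the first step then gives
    -- F_ε(μ 1) ≤ F_ε(μ 0).
    have h1 := sum_range_le_of_descent (F := fun l => mollifiedKL V ε (μ (l + 1)))
      (g := fun l => gradNormSq V ε (μ (l + 1))) (fun l => hstep (l + 1)) (fun l => hinf (l + 1)) T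
    have h2 : mollifiedKL V ε (μ 1) ≤ mollifiedKL V ε (μ 0) := by
      have := mul_nonneg hc.le (gradNormSq_nonneg (ε := ε) V (μ 0))
      linarith [hstep 0]
    have h3 : ∑ l ∈ Finset.Icc 1 T, gradNormSq V ε (μ l) =
        ∑ l ∈ Finset.range T, gradNormSq V ε (μ (l + 1)) := by
      rw [Finset.range_eq_Ico, Finset.sum_Ico_add' (fun l => gradNormSq V ε (μ l)) 0 T 1]
      rfl
    rw [h3, le_div_iff₀ (mul_pos hc hT')]
    calc _ = γ * (1 - γ * (L + n * h / ε ^ 4) / 2) *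
          ∑ l ∈ Finset.range T, gradNormSq V ε (μ (l + 1)) := by field_simp
      _ ≤ _ := h1.trans (by simpa using h2)
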